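/- Let $\mathcal G=(\mathrm V,\mathrm E)$ be a connected metric graph: every edge $e\in\mathrm E$ is identified with an interval $I_e=[0,\ell_e]$, $0<\ell_e<\infty$, or with a half-line $I_e=[0,+\infty)$, the end points of these intervals are glued at the vertices, and $\mathcal G$ carries the distance given by the shortest length of paths along the edges. Assume that $\mathcal G$ is locally finite: $\mathrm E$ is at most countable and every bounded subset of $\mathcal G$ intersects at most finitely many edges. Functions on $\mathcal G$ are identified with families $u=(u_e)_{e\in\mathrm E}$, $u_e:I_e\to\mathbb C$, and $\int_{\mathcal G}u\,dx:=\sum_{e\in\mathrm E}\int_{I_e}u_e\,dx$. Let $L^2(\mathcal G,\mathbb C)=\bigoplus_{e\in\mathrm E}L^2(I_e,\mathbb C)$ be the complex Hilbert space with inner product $(u,v)_2=\int_{\mathcal G}u\bar v\,dx$. Let $A=(A_e)_{e\in\mathrm E}$, $A_e:I_e\to\mathbb R$, and $V=(V_e)_{e\in\mathrm E}$, $V_e:I_e\to[1,+\infty)$, satisfy $A\in L^2(B)$ and $V\in L^1(B)$ for every bounded subset $B\subset\mathcal G$. Put $D_Au:=\frac1i u'-Au$, where $u'$ is the weak derivative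 on each edge, $$H^1_A(\mathcal G,\mathbb C):=\Big\{u\in C(\mathcal G,\mathbb C): D_Au\in L^2(\mathcal G,\mathbb C),\ \int_{\mathcal G}V|u|^2\,dx<+\infty\Big\},$$ and $$Q(u,v):=\int_{\mathcal G}\big(D_Au\,\overline{D_Av}+V u\bar v\big)\,dx,\qquad u,v\in H^1_A(\mathcal G,\mathbb C).$$ Then there exists a unique self-adjoint operator $T$ in $L^2(\mathcal G,\mathbb C)$ with domain $\operatorname{dom}(T)\subset H^1_A(\mathcal G,\mathbb C)$ such that $$Q(u,v)=(Tu,v)_2\qquad\text{for every }u\in\operatorname{dom}(T)\text{ and every }v\in H^1_A(\mathcal G,\mathbb C).$$ -/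

import Mathlib

open MeasureTheory Set
open scoped ENNReal ContDiff ComplexConjugate

/-- A metric graph with vertex set `𝒱` and edge set `ℰ` (loops and multiple edges are allowed).
Each edge has a length in `(0, +∞]` and an initial vertex, the one at coordinate `0`; an edge of
finite length also has a final vertex, whereas an edge of infinite length is a half-line. -/
structure MetricGraph (𝒱 ℰ : Type*) where
  /-- the length of an edge, `⊤` for a half-line -/
  len : ℰ → EReal
  len_pos : ∀ e, 0 < len e
  /-- the vertex at coordinate `0` -/
  start : ℰ → 𝒱
  /-- the vertex at coordinate `len e`, for an edge of finite length -/
  finish : ∀ e, len e ≠ ⊤ → 𝒱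

namespace MetricGraph

variable {𝒱 ℰ : Type*} (G : MetricGraph 𝒱 ℰ)

/-- The interval of an edge: `[0, len e]`, or `[0, +∞)` for a half-line. -/
def I (e : ℰ) : Set ℝ := {x | 0 ≤ x ∧ (x : EReal) ≤ G.len e}

/-- The points of the graph: the intervals of the edges with their end points glued together at the
vertices, that is, the vertices together with the interior points of the edges. -/
inductive Point : Type _
  | vertex (v : 𝒱) : Point
  | inner (e : ℰ) (x : ℝ) (h : 0 < x ∧ (x : EReal) < G.len e) : Point

open Classical in
/-- The parametrization of the edge `e`: the point of the graph with coordinate `x` on `e`. It is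
meant for `x ∈ G.I e`; it is constant to the left and to the right of this interval. -/
noncomputable def pt (e : ℰ) (x : ℝ) : G.Point :=
  if h : 0 < x ∧ (x : EReal) < G.len e then Point.inner e x h
  else if h' : 0 < x ∧ G.len e ≠ ⊤ then Point.vertex (G.finish e h'.2)
  else Point.vertex (G.start e)

/-- `G.Route p q L`: there is a path from `p` to `q` of total length `L`, composed of finitely many
segments, each of them contained in one edge. -/
inductive Route : G.Point → G.Point → ℝ≥0∞ → Prop
  | nil (p : G.Point) : Route p p 0
  | cons (e : ℰ) (s t : ℝ) (hs : s ∈ G.I e) (ht : t ∈ G.I e) (q : G.Point) (L : ℝ≥0∞)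
      (h : Route (G.pt e t) q L) : Route (G.pt e s) q (edist s t + L)

variable {G} in
theorem Route.append {p q r : G.Point} {L M : ℝ≥0∞} (h : G.Route p q L) (h' : G.Route q r M) :
    G.Route p r (L + M) := by
  induction h with
  | nil p => simpa using h'
  | cons e s t hs ht q L _ ih =>
    rw [add_assoc]
    exact Route.cons e s t hs ht r _ (ih h')

variable {G} in
theorem Route.reverse {p q : G.Point} {L : ℝ≥0∞} (h : G.Route p q L) : G.Route q p L := by
  induction h with
  | nil p => exact Route.nil p
  | cons e s t hs ht q L _ ih =>
    have h1 : G.Route (G.pt e t) (G.pt e s) (edist t s + 0) :=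
      Route.cons e t s ht hs _ _ (Route.nil _)
    rw [add_zero] at h1
    rw [edist_comm s t, add_comm]
    exact ih.append h1

/-- The distance along the edges: the infimum of the lengths of the paths that join two points. It
also provides the topology of the graph. (It is finite if the graph is connected.) -/
noncomputable instance : PseudoEMetricSpace G.Point where
  edist p q := sInf {L | G.Route p q L}
  edist_self p := le_antisymm (sInf_le (Route.nil p)) bot_le
  edist_comm p q := by
    congr 1
    ext L
    exact ⟨Route.reverse, Route.reverse⟩
  edist_triangle p q r := by
    rw [ENNReal.sInf_add]
    refine le_iInf₂ fun L hL => ?_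
    rw [add_comm, ENNReal.sInf_add]
    refine le_iInf₂ fun M hM => ?_
    rw [add_comm]
    exact sInf_le (Route.append hL hM)

/-- Any two points are joined by a path. -/
def Connected : Prop := ∀ p q : G.Point, ∃ L, G.Route p q L

/-- A set of points is bounded if its diameter is finite. -/
def Bounded (B : Set G.Point) : Prop := ∃ R : ℝ≥0∞, R < ⊤ ∧ ∀ p ∈ B, ∀ q ∈ B, edist p q ≤ R

/-- There are at most countably many edges, and every bounded set of points meets at most finitely
many (closed) edges. -/
def LocallyFinite : Prop :=
  Countable ℰ ∧ ∀ B : Set G.Point, G.Bounded B → {e | ∃ x ∈ G.I e, G.pt e x ∈ B}.Finite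

/-- The part of the edge `e` that lies in the set `B`, in the coordinate of `e`. -/
def edgePart (e : ℰ) (B : Set G.Point) : Set ℝ := {x | x ∈ G.I e ∧ G.pt e x ∈ B}

/-- `f ∈ L^p(B)` for a family `f = (f_e)` of functions on the edges, a set `B` of points and
`1 ≤ p < ∞`: every `f_e` is in `L^p` on the part of `e` in `B`, and
`∑ₑ ‖f_e‖ₚ ^ p < ∞`. -/
def MemLpOn {F : Type*} [NormedAddCommGroup F] (p : ℝ≥0∞) (f : ℰ → ℝ → F) (B : Set G.Point) :
    Prop :=
  (∀ e, MemLp (f e) p (volume.restrict (G.edgePart e B))) ∧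
    ∑' e, eLpNorm (f e) p (volume.restrict (G.edgePart e B)) ^ p.toReal < ⊤

/-- `f ∈ L^p_loc`: the function is in `L^p(B)` for every bounded subset `B` of the graph. -/
def MemLpLoc {F : Type*} [NormedAddCommGroup F] (p : ℝ≥0∞) (f : ℰ → ℝ → F) : Prop :=
  ∀ B : Set G.Point, G.Bounded B → G.MemLpOn p f B

/-- The complex Hilbert space `L²(𝒢, ℂ)`, the Hilbert sum of the spaces `L²(I_e, ℂ)`. -/
noncomputable abbrev L2 : Type _ := lp (fun e : ℰ => Lp ℂ 2 (volume.restrict (G.I e))) 2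

/-- The integral over the graph: `∫_𝒢 f dx = ∑ₑ ∫_{I_e} f_e dx`. -/
noncomputable def integral (f : ℰ → ℝ → ℂ) : ℂ := ∑' e, ∫ x in G.I e, f e x

/-- The family `(u_e)` of functions on the edges that belongs to a function on the graph. -/
noncomputable def onEdges (u : G.Point → ℂ) (e : ℰ) (x : ℝ) : ℂ := u (G.pt e x)

/-- `w` is a weak derivative of `f` on the open set `U ⊆ ℝ`. -/
def HasWeakDeriv (U : Set ℝ) (f w : ℝ → ℂ) : Prop :=
  LocallyIntegrableOn f U ∧ LocallyIntegrableOn w U ∧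
    ∀ φ : ℝ → ℂ, ContDiff ℝ ∞ φ → HasCompactSupport φ → tsupport φ ⊆ U →
      ∫ x in U, f x * deriv φ x = -∫ x in U, w x * φ x

open Classical in
/-- The weak derivative of `f` on `U` (unique up to null sets; `0` if there is none). -/
noncomputable def weakDeriv (U : Set ℝ) (f : ℝ → ℂ) : ℝ → ℂ :=
  if h : ∃ w, HasWeakDeriv U f w then h.choose else 0

/-- The magnetic derivative `D_A u = (1/i) u' - A u`, edge by edge. -/
noncomputable def magD (A : ℰ → ℝ → ℝ) (u : G.Point → ℂ) (e : ℰ) (x : ℝ) : ℂ :=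
  (1 / Complex.I) * weakDeriv (interior (G.I e)) (G.onEdges u e) x - A e x * G.onEdges u e x

/-- The magnetic Sobolev space `H¹_A(𝒢, ℂ)`: the continuous functions `u` on the graph (for the
distance along the edges) with `D_A u ∈ L²(𝒢, ℂ)` and `∫_𝒢 V |u|² dx < ∞`. -/
def H1A (A V : ℰ → ℝ → ℝ) : Set (G.Point → ℂ) :=
  {u | Continuous u ∧
    (∀ e, ∃ w, HasWeakDeriv (interior (G.I e)) (G.onEdges u e) w) ∧
    G.MemLpOn 2 (G.magD A u) univ ∧
    ∑' e, ∫⁻ x in G.I e, ENNReal.ofReal (V e x * ‖G.onEdges u e x‖ ^ 2) < ⊤}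

/-- The magnetic form `Q(u, v) = ∫_𝒢 (D_A u · conj (D_A v) + V u · conj v) dx`. -/
noncomputable def Q (A V : ℰ → ℝ → ℝ) (u v : G.Point → ℂ) : ℂ :=
  G.integral fun e x =>
    G.magD A u e x * conj (G.magD A v e x) + V e x * G.onEdges u e x * conj (G.onEdges v e x)

/-- The function `f` on the graph is a representative of the class `u ∈ L²(𝒢, ℂ)`. -/
def Represents (f : G.Point → ℂ) (u : G.L2) : Prop :=
  ∀ e, (u e : ℝ → ℂ) =ᵐ[volume.restrict (G.I e)] G.onEdges f e

end MetricGraph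

/-! Send `f` to the pair `(√V f, D_A f)` in `L² × L²`. Then `Q` becomes the inner product of the
image `formSpace`, and since `V ≥ 1` the map `J` from `formSpace` back to `f ∈ L²` is an injective
contraction. If `formSpace` is complete and `J` has dense range, then `J J†` is bounded, symmetric
and injective, and `T = (J J†)⁻¹` is self-adjoint. The relation `Q(f, v) = (h, v)₂` for all `v` says
exactly that the form element of `f` is `J† h`, that is, `u = J J† h`. Any other solution therefore
has its graph inside that of `T`, and self-adjoint operators have no proper self-adjoint extensions
(`existsUnique_isSelfAdjoint`).

Completeness (`isClosed_formSpace`) rests on the fundamental theorem of calculus for weak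
derivatives: on a bounded piece of an edge the form norm dominates the sup norm (`exists_norm_le`),
because `f' = i (D_A f + A f)` and `A` is locally `L²`. Local finiteness turns this into uniform
convergence on unit balls, so limits stay continuous across the vertices.

Density (`denseRange_of_familyRepresents`) holds because test functions inside a single edge,
extended by zero, lie in `H¹_A`. This is where `V ∈ L¹_loc` and `A ∈ L²_loc` give finite form norm.
-/

/-! ### Self-adjoint operators from a bounded embedding of Hilbert spaces. -/

section Operator

variable {H E : Type*} [NormedAddCommGroup H] [InnerProductSpace ℂ H] [CompleteSpace H]
  [NormedAddCommGroup E] [InnerProductSpace ℂ E] [CompleteSpace E]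

/-- The inverse of `J J†`, for an injective bounded operator `J` with dense range, is a
self-adjoint operator. -/
theorem exists_isSelfAdjoint_of_denseRange (J : H →L[ℂ] E) (hinj : Function.Injective J)
    (hdense : DenseRange J) :
    ∃ T : E →ₗ.[ℂ] E, IsSelfAdjoint T ∧
      ∀ u h : E, (u, h) ∈ T.graph ↔ u = J (J.adjoint h) := by
  -- The kernel of `J†` is orthogonal to the dense range of `J`. With injectivity of `J` this makes
  -- `J J†` injective, so the flipped graph `g` is the graph of an operator.
  have hadj : ∀ x, J.adjoint x = 0 → x = 0 := by
    intro x hx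
    refine hdense.eq_zero_of_inner_left ℂ (fun z => ?_)
    rw [← ContinuousLinearMap.adjoint_inner_left, hx, inner_zero_left]
  have hR : ∀ x, J (J.adjoint x) = 0 → x = 0 := fun x hx =>
    hadj x (hinj (hx.trans (map_zero J).symm))
  let g : Submodule ℂ (E × E) :=
    { carrier := {p | p.1 = J (J.adjoint p.2)}
      zero_mem' := by simp
      add_mem' := by
        intro a b ha hb
        simp only [mem_ofPred_eq] at ha hb ⊢
        simp [ha, hb]
      smul_mem' := by
        intro c a ha
        simp only [mem_ofPred_eq] at ha ⊢
        simp [ha] }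
  have hgraph : g.toLinearPMap.graph = g := by
    refine Submodule.toLinearPMap_graph_eq g ?_
    intro x hx hx1
    have hx' : x.1 = J (J.adjoint x.2) := hx
    exact hR _ (hx' ▸ hx1)
  have key : ∀ u h : E, (u, h) ∈ g.toLinearPMap.graph ↔ u = J (J.adjoint h) := by
    intro u h
    rw [hgraph]
    exact Iff.rfl
  refine ⟨g.toLinearPMap, ?_, key⟩
  have hdom : Dense (g.toLinearPMap.domain : Set E) := by
    rw [Submodule.dense_iff_topologicalClosure_eq_top,
      Submodule.topologicalClosure_eq_top_iff]
    rw [Submodule.eq_bot_iff]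
    intro x hx
    rw [Submodule.mem_orthogonal] at hx
    -- A vector `x` orthogonal to the domain is orthogonal to `J J† x`, whence `‖J† x‖² = 0`.
    have h1 := hx (J (J.adjoint x)) (LinearPMap.mem_domain_iff.2 ⟨x, (key _ _).2 rfl⟩)
    rw [← ContinuousLinearMap.adjoint_inner_right, inner_self_eq_zero] at h1
    exact hadj x h1
  rw [LinearPMap.isSelfAdjoint_def]
  apply LinearPMap.eq_of_eq_graph
  rw [LinearPMap.adjoint_graph_eq_graph_adjoint hdom]
  ext ⟨u, h⟩
  rw [Submodule.mem_adjoint_iff, key]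
  constructor
  · intro hh
    refine ext_inner_left ℂ fun b => ?_
    have := hh (J (J.adjoint b)) b ((key _ _).2 rfl)
    rw [sub_eq_zero] at this
    simp only at this
    rw [this, ← ContinuousLinearMap.adjoint_inner_right, ContinuousLinearMap.adjoint_inner_left]
  · intro hu a b hab
    rw [key] at hab
    rw [sub_eq_zero, hab]
    simp only [hu]
    rw [← ContinuousLinearMap.adjoint_inner_right, ContinuousLinearMap.adjoint_inner_left]

/-- A self-adjoint operator has no proper self-adjoint extension. -/
theorem IsSelfAdjoint.eq_of_le {S T : E →ₗ.[ℂ] E} (hS : IsSelfAdjoint S) (hT : IsSelfAdjoint T)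
    (hle : S ≤ T) : S = T := by
  refine le_antisymm hle ?_
  have h1 : T.IsFormalAdjoint T := by
    have := LinearPMap.adjoint_isFormalAdjoint hT.dense_domain
    rwa [LinearPMap.isSelfAdjoint_def.1 hT] at this
  -- As `T` is symmetric and extends `S`, it is formally adjoint to `S`, so `T ≤ S† = S`.
  have h2 : S.IsFormalAdjoint T := by
    intro x y
    have hx : S x = T ⟨x, hle.1 x.2⟩ := hle.2 (y := ⟨x, hle.1 x.2⟩) rfl
    rw [hx]
    exact h1 _ _
  have := h2.le_adjoint hS.dense_domain
  rwa [LinearPMap.isSelfAdjoint_def.1 hS] at this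

/-- The first representation theorem, for the form `⟪x, y⟫` on `H` embedded in `E` by `J`. -/
theorem existsUnique_isSelfAdjoint (J : H →L[ℂ] E) (hinj : Function.Injective J)
    (hdense : DenseRange J) :
    ∃! T : E →ₗ.[ℂ] E, IsSelfAdjoint T ∧
      ∀ u : T.domain, ∃ x : H, J x = u ∧ ∀ y, inner ℂ y x = inner ℂ (J y) (T u) := by
  obtain ⟨T, hT, hgraph⟩ := exists_isSelfAdjoint_of_denseRange J hinj hdense
  refine ⟨T, ⟨hT, fun u => ⟨J.adjoint (T u), ((hgraph u (T u)).1 (T.mem_graph u)).symm,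
    fun y => ContinuousLinearMap.adjoint_inner_right J y (T u)⟩⟩, ?_⟩
  rintro S ⟨hS, hSf⟩
  -- The form identity for `S` says `x = J† (S u)`, so `u = J J† (S u)` and the graph of `S` lies in
  -- that of `T`.
  refine hS.eq_of_le hT (LinearPMap.le_of_le_graph ?_)
  rintro ⟨u, h⟩ huh
  obtain ⟨u', hu', rfl⟩ := (LinearPMap.mem_graph_iff S).1 huh
  simp only at hu'
  subst hu'
  obtain ⟨x, hx, hy⟩ := hSf u'
  rw [hgraph, ← hx]
  congr 1
  exact ext_inner_left ℂ fun y => by rw [hy, ContinuousLinearMap.adjoint_inner_right]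

end Operator

/-! ### Edges, distances and bounded sets of the metric graph. -/

namespace MetricGraph

variable {𝒱 ℰ : Type*} (G : MetricGraph 𝒱 ℰ)

theorem I_eq_Ici_or_Icc (e : ℰ) :
    (G.len e = ⊤ ∧ G.I e = Ici 0) ∨
      ∃ l : ℝ, 0 < l ∧ G.len e = (l : EReal) ∧ G.I e = Icc 0 l := by
  have hpos := G.len_pos e
  unfold I
  induction h : G.len e with
  | bot => simp [h] at hpos
  | top =>
    left
    refine ⟨rfl, ?_⟩
    ext x
    simp
  | coe l =>
    right
    rw [h] at hpos
    refine ⟨l, by exact_mod_cast hpos, rfl, ?_⟩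
    ext x
    simp

theorem isClosed_I (e : ℰ) : IsClosed (G.I e) := by
  rcases G.I_eq_Ici_or_Icc e with ⟨-, h⟩ | ⟨l, -, -, h⟩ <;> rw [h]
  · exact isClosed_Ici
  · exact isClosed_Icc

theorem measurableSet_I (e : ℰ) : MeasurableSet (G.I e) := (G.isClosed_I e).measurableSet

theorem convex_I (e : ℰ) : Convex ℝ (G.I e) := by
  rcases G.I_eq_Ici_or_Icc e with ⟨-, h⟩ | ⟨l, -, -, h⟩ <;> rw [h]
  · exact convex_Ici 0
  · exact convex_Icc 0 l

theorem interior_I (e : ℰ) : interior (G.I e) = {x : ℝ | 0 < x ∧ (x : EReal) < G.len e} := by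
  rcases G.I_eq_Ici_or_Icc e with ⟨h', h⟩ | ⟨l, -, h', h⟩ <;> rw [h, h']
  · rw [interior_Ici]
    ext x
    simp
  · rw [interior_Icc]
    ext x
    simp

theorem zero_mem_I (e : ℰ) : (0 : ℝ) ∈ G.I e :=
  ⟨le_rfl, by simpa using (G.len_pos e).le⟩

theorem exists_Icc_subset_I (e : ℰ) : ∃ l : ℝ, 0 < l ∧ Icc 0 l ⊆ G.I e := by
  rcases G.I_eq_Ici_or_Icc e with ⟨-, h⟩ | ⟨l, hl, -, h⟩ <;> rw [h]
  · exact ⟨1, one_pos, Icc_subset_Ici_self⟩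
  · exact ⟨l, hl, le_rfl⟩

theorem interior_I_ae_eq (e : ℰ) : interior (G.I e) =ᵐ[volume] G.I e :=
  interior_ae_eq_of_null_frontier ((G.convex_I e).addHaar_frontier volume)

/-- End points are null sets: weak derivatives live on the open interval, `L²` classes on the closed
one, and this lets them be compared. -/
theorem restrict_interior_I (e : ℰ) :
    volume.restrict (interior (G.I e)) = volume.restrict (G.I e) :=
  Measure.restrict_congr_set (G.interior_I_ae_eq e)

variable {G}

theorem pt_of_mem_interior {e : ℰ} {x : ℝ} (h : 0 < x ∧ (x : EReal) < G.len e) :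
    G.pt e x = Point.inner e x h := by
  unfold pt
  rw [dif_pos h]

theorem edist_le_of_route {p q : G.Point} {L : ℝ≥0∞} (h : G.Route p q L) : edist p q ≤ L :=
  sInf_le h

theorem edist_pt_le {e : ℰ} {s t : ℝ} (hs : s ∈ G.I e) (ht : t ∈ G.I e) :
    edist (G.pt e s) (G.pt e t) ≤ edist s t := by
  simpa using edist_le_of_route (Route.cons e s t hs ht _ _ (Route.nil _))

theorem continuousOn_pt (e : ℰ) : ContinuousOn (G.pt e) (G.I e) := by
  have : LipschitzOnWith 1 (G.pt e) (G.I e) := by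
    intro s hs t ht
    simpa using edist_pt_le hs ht
  exact this.continuousOn

theorem continuousOn_onEdges {u : G.Point → ℂ} (hu : Continuous u) (e : ℰ) :
    ContinuousOn (G.onEdges u e) (G.I e) :=
  hu.comp_continuousOn (continuousOn_pt e)

/-- A function on the graph that is `K`-Lipschitz along every edge is `K`-Lipschitz. -/
theorem lipschitzWith_of_edges (hconn : G.Connected) {α : Type*} [PseudoEMetricSpace α]
    {F : G.Point → α} {K : NNReal}
    (h : ∀ e, LipschitzOnWith K (fun x => F (G.pt e x)) (G.I e)) : LipschitzWith K F := by
  intro p q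
  have hroute : ∀ (p q : G.Point) L, G.Route p q L → edist (F p) (F q) ≤ K * L := by
    intro p q L hL
    induction hL with
    | nil p => simp
    | cons e s t hs ht q L _ ih =>
      rw [mul_add]
      exact (edist_triangle _ (F (G.pt e t)) _).trans (add_le_add (h e hs ht) ih)
  have h1 : (edist p q : ℝ≥0∞) = ⨅ L ∈ {L | G.Route p q L}, L := sInf_eq_iInf
  obtain ⟨L₀, hL₀⟩ := hconn p q
  -- A zero factor cannot be moved inside an infimum over a possibly empty family. For `K = 0` the
  -- single route given by connectedness suffices.
  by_cases hK : (K : ℝ≥0∞) = 0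
  · have := hroute p q L₀ hL₀
    rw [hK, zero_mul] at this ⊢
    exact this
  · rw [h1, ENNReal.mul_iInf_of_ne hK ENNReal.coe_ne_top]
    refine le_iInf fun L => ?_
    rw [ENNReal.mul_iInf_of_ne hK ENNReal.coe_ne_top]
    exact le_iInf fun hL => hroute p q L hL

/-- Once there is an edge, connectedness excludes isolated vertices: a route from `p` to a point of
`e` is empty or its first segment starts at `p`. -/
theorem exists_pt_eq (hconn : G.Connected) (e : ℰ) (p : G.Point) :
    ∃ e', ∃ x ∈ G.I e', G.pt e' x = p := by
  obtain ⟨L, hL⟩ := hconn p (G.pt e 0)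
  generalize hq : G.pt e 0 = q at hL
  cases hL with
  | nil => exact ⟨e, 0, G.zero_mem_I e, hq⟩
  | cons e' s t hs ht _ L h => exact ⟨e', s, hs, rfl⟩

open Classical in
/-- The function on the graph that is `φ` on the interior of the edge `e` and zero elsewhere. -/
noncomputable def extendByZero {β : Type*} [Zero β] (e : ℰ) (φ : ℝ → β) : G.Point → β
  | .vertex _ => 0
  | .inner e' x _ => if e' = e then φ x else 0

open Classical in
theorem extendByZero_pt {β : Type*} [Zero β] {e : ℰ} {φ : ℝ → β}
    (hφ : ∀ x, x ∉ interior (G.I e) → φ x = 0) (e' : ℰ) (x : ℝ) :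
    G.extendByZero e φ (G.pt e' x) = if e' = e then φ x else 0 := by
  by_cases h : 0 < x ∧ (x : EReal) < G.len e'
  · rw [pt_of_mem_interior h]
    rfl
  · have h1 : G.extendByZero e φ (G.pt e' x) = 0 := by
      unfold pt
      rw [dif_neg h]
      split_ifs <;> rfl
    rw [h1]
    split_ifs with he
    · subst he
      rw [hφ x]
      rw [interior_I]
      exact h
    · rfl

/-- Serves two purposes: continuity of extended test functions, and, with `φ x = max x 0` on a
half-line, a comparison of graph distance with the coordinate. -/
theorem lipschitzWith_extendByZero {β : Type*} [SeminormedAddCommGroup β] {e : ℰ} {φ : ℝ → β}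
    (hφ : ∀ x, x ∉ interior (G.I e) → φ x = 0) {K : NNReal} (hK : LipschitzWith K φ)
    (hconn : G.Connected) :
    LipschitzWith K (G.extendByZero e φ) := by
  refine lipschitzWith_of_edges hconn fun e' => ?_
  simp only [extendByZero_pt hφ]
  by_cases he : e' = e
  · simpa [he] using hK.lipschitzOnWith
  · simp only [he, if_false]
    exact (LipschitzWith.const' (0 : β)).lipschitzOnWith

/-- On a half-line the coordinate, extended by zero to the graph, is 1-Lipschitz, so it varies by at
most `1` from its value at `p`. -/
theorem exists_edgePart_ball_subset (hconn : G.Connected) (e : ℰ) (p : G.Point) :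
    ∃ n : ℕ, G.edgePart e (Metric.eball p 1) ⊆ Icc 0 (n : ℝ) := by
  rcases G.I_eq_Ici_or_Icc e with ⟨htop, h⟩ | ⟨l, hl, -, h⟩
  · have hz : ∀ x, x ∉ interior (G.I e) → max x 0 = 0 := by
      intro x hx
      rw [h, interior_Ici, mem_Ioi, not_lt] at hx
      exact max_eq_right hx
    have hlip : LipschitzWith 1 fun x : ℝ => max x 0 := LipschitzWith.id.max_const 0
    have hF := lipschitzWith_extendByZero hz hlip hconn
    obtain ⟨n, hn⟩ := exists_nat_ge (G.extendByZero e (fun x : ℝ => max x 0) p + 1)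
    refine ⟨n, fun x hx => ?_⟩
    have h0 : 0 ≤ x := hx.1.1
    refine ⟨h0, ?_⟩
    have h1 := hF (G.pt e x) p
    have h2 : edist (G.pt e x) p < 1 := hx.2
    rw [extendByZero_pt hz, if_pos rfl, max_eq_left h0, edist_dist, Real.dist_eq] at h1
    have h3 : ENNReal.ofReal |x - G.extendByZero e (fun x : ℝ => max x 0) p| ≤ 1 := by
      refine h1.trans ?_
      simpa using h2.le
    rw [ENNReal.ofReal_le_one] at h3
    have := (abs_le.1 h3).2
    linarith
  · obtain ⟨n, hn⟩ := exists_nat_ge l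
    refine ⟨n, fun x hx => ?_⟩
    have := hx.1
    rw [h] at this
    exact ⟨this.1, this.2.trans hn⟩

theorem bounded_image_pt (e : ℰ) (n : ℕ) : G.Bounded (G.pt e '' (G.I e ∩ Icc 0 (n : ℝ))) := by
  refine ⟨ENNReal.ofReal n, ENNReal.ofReal_lt_top, ?_⟩
  rintro _ ⟨s, hs, rfl⟩ _ ⟨t, ht, rfl⟩
  refine (edist_pt_le hs.1 ht.1).trans ?_
  rw [edist_dist]
  refine ENNReal.ofReal_le_ofReal ?_
  rw [Real.dist_eq, abs_le]
  constructor <;> linarith [hs.2.1, hs.2.2, ht.2.1, ht.2.2]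

theorem bounded_ball (p : G.Point) : G.Bounded (Metric.eball p 1) := by
  refine ⟨1 + 1, by simp, fun q hq r hr => ?_⟩
  refine (edist_triangle q p r).trans (add_le_add ?_ ?_)
  · exact (Metric.mem_eball.1 hq).le
  · exact (Metric.mem_eball'.1 hr).le

/-- A local `L^p` function on the graph is in `L^p` on the bounded parts of each edge. -/
theorem MemLpLoc.memLp {F : Type*} [NormedAddCommGroup F] {p : ℝ≥0∞} {f : ℰ → ℝ → F}
    (hf : G.MemLpLoc p f) (e : ℰ) (n : ℕ) :
    MemLp (f e) p (volume.restrict (G.I e ∩ Icc 0 (n : ℝ))) := by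
  refine ((hf _ (bounded_image_pt e n)).1 e).mono_measure (Measure.restrict_mono_set _ ?_)
  exact fun x hx => ⟨hx.1, x, hx, rfl⟩

theorem iUnion_I_inter (e : ℰ) : ⋃ n : ℕ, G.I e ∩ Icc 0 (n : ℝ) = G.I e := by
  rw [← inter_iUnion, inter_eq_left]
  intro x hx
  obtain ⟨n, hn⟩ := exists_nat_ge x
  exact mem_iUnion.2 ⟨n, hx.1, hn⟩

theorem MemLpLoc.aestronglyMeasurable {F : Type*} [NormedAddCommGroup F] {p : ℝ≥0∞}
    {f : ℰ → ℝ → F} (hf : G.MemLpLoc p f) (e : ℰ) :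
    AEStronglyMeasurable (f e) (volume.restrict (G.I e)) := by
  rw [← iUnion_I_inter]
  exact AEStronglyMeasurable.iUnion fun n => (hf.memLp e n).aestronglyMeasurable

theorem isCompact_I_inter (e : ℰ) (n : ℕ) : IsCompact (G.I e ∩ Icc 0 (n : ℝ)) :=
  isCompact_Icc.inter_left (G.isClosed_I e)

theorem convex_I_inter (e : ℰ) (n : ℕ) : Convex ℝ (G.I e ∩ Icc 0 (n : ℝ)) :=
  (G.convex_I e).inter (convex_Icc _ _)

theorem exists_subset_I_inter {e : ℰ} {K : Set ℝ} (hK : IsCompact K) (hKI : K ⊆ G.I e) :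
    ∃ n : ℕ, K ⊆ G.I e ∩ Icc 0 (n : ℝ) := by
  obtain ⟨M, hM⟩ := hK.bddAbove
  obtain ⟨n, hn⟩ := exists_nat_ge M
  exact ⟨n, fun x hx => ⟨hKI hx, (hKI hx).1, (hM hx).trans hn⟩⟩

theorem edgePart_univ (e : ℰ) : G.edgePart e univ = G.I e := by
  simp [edgePart]

end MetricGraph

/-! ### Weak derivatives on open subsets of the line. -/

namespace MetricGraph

section WeakDeriv

open Filter Topology

variable {U : Set ℝ} {f f₁ f₂ w w₁ w₂ : ℝ → ℂ}

theorem integrableOn_mul_testFunction (hw : LocallyIntegrableOn w U) (hU : IsOpen U) {φ : ℝ → ℂ}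
    (hφ : Continuous φ) (hc : HasCompactSupport φ) (hs : tsupport φ ⊆ U) :
    IntegrableOn (fun x => w x * φ x) U := by
  have h1 : IntegrableOn (fun x => w x * φ x) (tsupport φ) :=
    IntegrableOn.mul_continuousOn (hw.integrableOn_compact_subset hs hc) hφ.continuousOn hc
  refine h1.of_forall_sdiff_eq_zero hU.measurableSet fun x hx => ?_
  rw [image_eq_zero_of_notMem_tsupport hx.2, mul_zero]

theorem HasWeakDeriv.add (hU : IsOpen U) (h₁ : HasWeakDeriv U f₁ w₁) (h₂ : HasWeakDeriv U f₂ w₂) :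
    HasWeakDeriv U (f₁ + f₂) (w₁ + w₂) := by
  refine ⟨h₁.1.add h₂.1, h₁.2.1.add h₂.2.1, fun φ hφ hc hs => ?_⟩
  have hd : Continuous (deriv φ) := hφ.continuous_deriv (by simp)
  have hs' : tsupport (deriv φ) ⊆ U := (closure_minimal support_deriv_subset
    (isClosed_tsupport φ)).trans hs
  simp only [Pi.add_apply, add_mul]
  rw [integral_add (integrableOn_mul_testFunction h₁.1 hU hd hc.deriv hs')
    (integrableOn_mul_testFunction h₂.1 hU hd hc.deriv hs'),
    integral_add (integrableOn_mul_testFunction h₁.2.1 hU hφ.continuous hc hs)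
    (integrableOn_mul_testFunction h₂.2.1 hU hφ.continuous hc hs), h₁.2.2 φ hφ hc hs,
    h₂.2.2 φ hφ hc hs]
  ring

theorem HasWeakDeriv.const_mul (c : ℂ) (h : HasWeakDeriv U f w) :
    HasWeakDeriv U (fun x => c * f x) (fun x => c * w x) := by
  refine ⟨h.1.smul c, h.2.1.smul c, fun φ hφ hc hs => ?_⟩
  simp only [mul_assoc]
  rw [integral_const_mul, integral_const_mul, h.2.2 φ hφ hc hs]
  ring

theorem HasWeakDeriv.congr_deriv (h : HasWeakDeriv U f w₁) (hw : w₁ =ᵐ[volume.restrict U] w₂) :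
    HasWeakDeriv U f w₂ := by
  refine ⟨h.1, h.2.1.congr hw, fun φ hφ hc hs => ?_⟩
  rw [h.2.2 φ hφ hc hs]
  congr 1
  refine integral_congr_ae ?_
  filter_upwards [hw] with x hx
  rw [hx]

/-- Weak derivatives are unique up to null sets. -/
theorem HasWeakDeriv.ae_eq (hU : IsOpen U) (h₁ : HasWeakDeriv U f w₁) (h₂ : HasWeakDeriv U f w₂) :
    w₁ =ᵐ[volume.restrict U] w₂ := by
  have h := hU.ae_eq_zero_of_integral_contDiff_smul_eq_zero (μ := volume)
    (h₁.2.1.sub h₂.2.1) ?_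
  · rw [EventuallyEq, ae_restrict_iff' hU.measurableSet]
    filter_upwards [h] with x hx hxU
    exact sub_eq_zero.1 (hx hxU)
  · intro g hg hc hs
    -- The fundamental lemma tests with real functions, `HasWeakDeriv` with complex ones.
    have hg' : ContDiff ℝ ∞ (fun x => (g x : ℂ)) := Complex.ofRealCLM.contDiff.comp hg
    have hc' : HasCompactSupport (fun x => (g x : ℂ)) := hc.comp_left Complex.ofReal_zero
    have hs' : tsupport (fun x => (g x : ℂ)) ⊆ U :=
      (closure_mono (Function.support_comp_subset Complex.ofReal_zero g)).trans hs
    have h3 := (h₁.2.2 _ hg' hc' hs').symm.trans (h₂.2.2 _ hg' hc' hs')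
    have h4 : ∫ x, g x • (w₁ - w₂) x = ∫ x in U, g x • (w₁ - w₂) x := by
      rw [setIntegral_eq_integral_of_forall_compl_eq_zero]
      intro x hx
      rw [image_eq_zero_of_notMem_tsupport (fun h => hx (hs h)), zero_smul]
    rw [h4]
    simp only [Pi.sub_apply, Complex.real_smul, mul_comm (g _ : ℂ)]
    simp only [sub_mul]
    rw [integral_sub (integrableOn_mul_testFunction h₁.2.1 hU hg'.continuous hc' hs')
      (integrableOn_mul_testFunction h₂.2.1 hU hg'.continuous hc' hs'), sub_eq_zero]
    exact neg_injective h3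

theorem HasWeakDeriv.weakDeriv_ae_eq (hU : IsOpen U) (h : HasWeakDeriv U f w) :
    weakDeriv U f =ᵐ[volume.restrict U] w := by
  have h' : ∃ w, HasWeakDeriv U f w := ⟨w, h⟩
  unfold weakDeriv
  rw [dif_pos h']
  exact h'.choose_spec.ae_eq hU h

theorem hasWeakDeriv_weakDeriv (h : ∃ w, HasWeakDeriv U f w) :
    HasWeakDeriv U f (weakDeriv U f) := by
  unfold weakDeriv
  rw [dif_pos h]
  exact h.choose_spec

/-- A continuously differentiable function with compact support is weakly differentiable. -/
theorem hasWeakDeriv_deriv (hU : IsOpen U) (hf : ContDiff ℝ 1 f) : HasWeakDeriv U f (deriv f) := by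
  have hd : Continuous (deriv f) := hf.continuous_deriv le_rfl
  refine ⟨hf.continuous.continuousOn.locallyIntegrableOn hU.measurableSet,
    hd.continuousOn.locallyIntegrableOn hU.measurableSet, fun φ hφ hc hs => ?_⟩
  have hdφ : Continuous (deriv φ) := hφ.continuous_deriv (by simp)
  have hz : ∀ x, x ∉ U → φ x = 0 := fun x hx =>
    image_eq_zero_of_notMem_tsupport (fun h => hx (hs h))
  have hz' : ∀ x, x ∉ U → deriv φ x = 0 := fun x hx =>
    Function.notMem_support.1 (fun h => hx (hs (support_deriv_subset h)))
  rw [setIntegral_eq_integral_of_forall_compl_eq_zero (fun x hx => by rw [hz' x hx, mul_zero]),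
    setIntegral_eq_integral_of_forall_compl_eq_zero (fun x hx => by rw [hz x hx, mul_zero])]
  refine integral_mul_deriv_eq_deriv_mul_of_integrable
    (fun x _ => (hf.differentiable one_ne_zero x).hasDerivAt)
    (fun x _ => (hφ.differentiable (by simp) x).hasDerivAt) ?_ ?_ ?_
  · exact (hf.continuous.mul hdφ).integrable_of_hasCompactSupport hc.deriv.mul_left
  · exact (hd.mul hφ.continuous).integrable_of_hasCompactSupport hc.mul_left
  · exact (hf.continuous.mul hφ.continuous).integrable_of_hasCompactSupport hc.mul_left

/-- The fundamental theorem of calculus for weak derivatives. -/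
theorem HasWeakDeriv.integral_eq_sub (hU : IsOpen U) (hf : ContinuousOn f U)
    (h : HasWeakDeriv U f w) {x y : ℝ} (hxy : x < y) (hs : Icc x y ⊆ U) :
    ∫ t in Ico x y, w t = f y - f x := by
  obtain ⟨a, hax, haU⟩ : ∃ a, a < x ∧ Icc a x ⊆ U := by
    obtain ⟨ε, hε, hεU⟩ := Metric.isOpen_iff.1 hU x (hs ⟨le_rfl, hxy.le⟩)
    refine ⟨x - ε / 2, by linarith, fun t ht => hεU ?_⟩
    rw [Metric.mem_ball, Real.dist_eq, abs_lt]
    constructor <;> linarith [ht.1, ht.2]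
  obtain ⟨b, hyb, hbU⟩ : ∃ b, y < b ∧ Icc y b ⊆ U := by
    obtain ⟨ε, hε, hεU⟩ := Metric.isOpen_iff.1 hU y (hs ⟨hxy.le, le_rfl⟩)
    refine ⟨y + ε / 2, by linarith, fun t ht => hεU ?_⟩
    rw [Metric.mem_ball, Real.dist_eq, abs_lt]
    constructor <;> linarith [ht.1, ht.2]
  have hK : Icc a b ⊆ U := by
    intro t ht
    rcases le_total t x with h1 | h1
    · exact haU ⟨ht.1, h1⟩
    rcases le_total t y with h2 | h2
    · exact hs ⟨h1, h2⟩
    · exact hbU ⟨h2, ht.2⟩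
  -- `S` is a smooth step from `0` to `1`, so `c S'(c (z - t))` is an approximate identity at `z` as
  -- `c → ∞`. This recovers the point values of `f`.
  let S := Real.smoothTransition
  have hSd : ContDiff ℝ ∞ S := Real.smoothTransition.contDiff
  have hSdiff : Differentiable ℝ S := hSd.differentiable (by simp)
  have hS'c : Continuous (deriv S) := hSd.continuous_deriv (by simp)
  have hS'0 : ∀ t, 0 ≤ deriv S t := fun t => Real.smoothTransition.monotone.deriv_nonneg
  have hS'supp : ∀ t, t ∉ Icc (0 : ℝ) 1 → deriv S t = 0 := by
    intro t ht
    rw [mem_Icc, not_and_or, not_le, not_le] at ht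
    rcases ht with ht | ht
    · have : S =ᶠ[𝓝 t] fun _ => 0 := by
        filter_upwards [Iio_mem_nhds ht] with s hs
        exact Real.smoothTransition.zero_of_nonpos (le_of_lt hs)
      rw [this.deriv_eq, deriv_const]
    · have : S =ᶠ[𝓝 t] fun _ => 1 := by
        filter_upwards [Ioi_mem_nhds ht] with s hs
        exact Real.smoothTransition.one_of_one_le (le_of_lt hs)
      rw [this.deriv_eq, deriv_const]
  have hS'cs : HasCompactSupport (deriv S) := HasCompactSupport.intro isCompact_Icc hS'supp
  have hS'1 : ∫ t, deriv S t = 1 := by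
    rw [← setIntegral_eq_integral_of_forall_compl_eq_zero hS'supp,
      integral_Icc_eq_integral_Ioc, ← intervalIntegral.integral_of_le zero_le_one,
      intervalIntegral.integral_deriv_eq_sub (fun t _ => hSdiff t)
        (hS'c.intervalIntegrable _ _)]
    simp [S]
  have hS'lim : Tendsto (fun t : ℝ => ‖t‖ ^ Module.finrank ℝ ℝ * deriv S t)
      (Bornology.cobounded ℝ) (𝓝 0) := by
    refine tendsto_const_nhds.congr' ?_
    have := hS'cs.isCompact.isBounded
    filter_upwards [Bornology.isBounded_def.1 this] with t ht
    rw [image_eq_zero_of_notMem_tsupport ht, mul_zero]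
  -- Cutting off makes `f` integrable on the line without changing it near `x` and `y`.
  let F : ℝ → ℂ := (Icc a b).indicator f
  have hFint : Integrable F := by
    rw [integrable_indicator_iff measurableSet_Icc]
    exact (hf.mono hK).integrableOn_compact isCompact_Icc
  have hFc : ∀ z ∈ Ioo a b, ContinuousAt F z ∧ F z = f z := by
    intro z hz
    have hzK : z ∈ Icc a b := Ioo_subset_Icc_self hz
    refine ⟨?_, indicator_of_mem hzK f⟩
    have : F =ᶠ[𝓝 z] f := by
      filter_upwards [Ioo_mem_nhds hz.1 hz.2] with t ht
      exact indicator_of_mem (Ioo_subset_Icc_self ht) f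
    rw [continuousAt_congr this]
    exact hf.continuousAt (hU.mem_nhds (hK hzK))
  have hpeak : ∀ z ∈ Ioo a b,
      Tendsto (fun c : ℝ => ∫ t, ((c * deriv S (c * (z - t)) : ℝ) : ℂ) * F t) atTop (𝓝 (f z)) := by
    intro z hz
    have := tendsto_integral_comp_smul_smul_of_integrable' (μ := volume) hS'0 hS'1 hS'lim hFint
      (hFc z hz).1
    rw [(hFc z hz).2] at this
    simpa using this
  -- For `c ≥ 1 / (x - a)` this is a test function supported in `[a, y]`. Since `S 0 = 0`, its
  -- pointwise limit is exactly the indicator of the half-open `Ico x y`.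
  let φ : ℝ → ℝ → ℝ := fun c t => S (c * (y - t)) - S (c * (x - t))
  have hφd : ∀ c, ContDiff ℝ ∞ (φ c) := fun c =>
    (hSd.comp (contDiff_const.mul (contDiff_const.sub contDiff_id))).sub
      (hSd.comp (contDiff_const.mul (contDiff_const.sub contDiff_id)))
  have hφ' : ∀ c t, HasDerivAt (φ c) (c * deriv S (c * (x - t)) - c * deriv S (c * (y - t))) t := by
    intro c t
    have h1 : ∀ z, HasDerivAt (fun t => S (c * (z - t))) (deriv S (c * (z - t)) * (c * (-1))) t :=
      fun z => (hSdiff _).hasDerivAt.comp t (((hasDerivAt_id t).const_sub z).const_mul c)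
    exact ((h1 y).sub (h1 x)).congr_deriv (by ring)
  have hφbd : ∀ c t, |φ c t| ≤ 1 := by
    intro c t
    have h1 := Real.smoothTransition.nonneg (c * (y - t))
    have h2 := Real.smoothTransition.le_one (c * (y - t))
    have h3 := Real.smoothTransition.nonneg (c * (x - t))
    have h4 := Real.smoothTransition.le_one (c * (x - t))
    rw [abs_le]
    constructor <;> simp only [φ, S] <;> linarith
  have hφz : ∀ c, 0 < c → 1 ≤ c * (x - a) → ∀ t, t ∉ Icc a y → φ c t = 0 := by
    intro c hc0 hc t ht
    rw [mem_Icc, not_and_or, not_le, not_le] at ht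
    simp only [φ, S]
    rcases ht with ht | ht
    · rw [Real.smoothTransition.one_of_one_le, Real.smoothTransition.one_of_one_le, sub_self]
      · nlinarith
      · nlinarith
    · rw [Real.smoothTransition.zero_of_nonpos, Real.smoothTransition.zero_of_nonpos, sub_self]
      · nlinarith
      · nlinarith
  have hev : ∀ᶠ c : ℝ in atTop, 0 < c ∧ 1 ≤ c * (x - a) := by
    filter_upwards [eventually_gt_atTop 0, eventually_ge_atTop (1 / (x - a))] with c h1 h2
    refine ⟨h1, ?_⟩
    rwa [div_le_iff₀ (by linarith)] at h2
  have hyK : Icc a y ⊆ Icc a b := Icc_subset_Icc_right hyb.le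
  have hweak : ∀ᶠ c : ℝ in atTop,
      (∫ t, ((c * deriv S (c * (x - t)) : ℝ) : ℂ) * F t) -
        (∫ t, ((c * deriv S (c * (y - t)) : ℝ) : ℂ) * F t) =
        -∫ t in Icc a b, w t * φ c t := by
    filter_upwards [hev] with c hc
    have hz := hφz c hc.1 hc.2
    have hts : tsupport (fun t => (φ c t : ℂ)) ⊆ Icc a y := by
      refine closure_minimal (fun t ht => ?_) isClosed_Icc
      by_contra hcon
      exact ht (by simp [hz t hcon])
    have h1 := h.2.2 (fun t => (φ c t : ℂ)) (Complex.ofRealCLM.contDiff.comp (hφd c))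
      (HasCompactSupport.of_support_subset_isCompact isCompact_Icc
        ((subset_tsupport _).trans hts)) (hts.trans (hyK.trans hK))
    have hder : ∀ t, deriv (fun t => (φ c t : ℂ)) t =
        ((c * deriv S (c * (x - t)) : ℝ) : ℂ) - ((c * deriv S (c * (y - t)) : ℝ) : ℂ) := by
      intro t
      rw [← Complex.ofReal_sub]
      exact (hφ' c t).ofReal_comp.deriv
    have hder0 : ∀ t, t ∉ Icc a y → deriv (fun t => (φ c t : ℂ)) t = 0 := fun t ht =>
      Function.notMem_support.1 fun hh => ht (hts (support_deriv_subset hh))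
    have hint : ∀ z, Integrable fun t => ((c * deriv S (c * (z - t)) : ℝ) : ℂ) * F t := by
      intro z
      obtain ⟨C, hC⟩ := hS'cs.exists_bound_of_continuous hS'c
      refine hFint.bdd_mul (c := c * C) ?_ (ae_of_all _ fun t => ?_)
      · exact (Complex.continuous_ofReal.comp
          (continuous_const.mul (hS'c.comp (by fun_prop)))).aestronglyMeasurable
      · rw [Complex.norm_real, norm_mul, Real.norm_of_nonneg hc.1.le]
        exact mul_le_mul_of_nonneg_left (hC _) hc.1.le
    have h2 : ∫ t in U, f t * deriv (fun t => (φ c t : ℂ)) t =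
        ∫ t, (((c * deriv S (c * (x - t)) : ℝ) : ℂ) * F t -
          ((c * deriv S (c * (y - t)) : ℝ) : ℂ) * F t) := by
      rw [← integral_indicator hU.measurableSet]
      congr 1
      ext t
      rw [← sub_mul, ← hder]
      by_cases ht : t ∈ Icc a y
      · rw [indicator_of_mem (hK (hyK ht)),
          show F t = f t from indicator_of_mem (hyK ht) f, mul_comm]
      · rw [hder0 t ht, zero_mul, indicator_apply_eq_zero]
        intro _
        rw [hder0 t ht, mul_zero]
    have h3 : ∫ t in U, w t * (φ c t : ℂ) = ∫ t in Icc a b, w t * φ c t := by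
      refine setIntegral_eq_of_subset_of_forall_sdiff_eq_zero hU.measurableSet hK fun t ht => ?_
      rw [hz t (fun hh => ht.2 (hyK hh)), Complex.ofReal_zero, mul_zero]
    rw [← integral_sub (hint x) (hint y), ← h2, h1, h3]
  have hlim : Tendsto (fun c : ℝ => ∫ t in Icc a b, w t * φ c t) atTop
      (𝓝 (∫ t in Icc a b, (Ico x y).indicator w t)) := by
    have hwK : IntegrableOn w (Icc a b) := h.2.1.integrableOn_compact_subset hK isCompact_Icc
    refine tendsto_integral_filter_of_dominated_convergence (fun t => ‖w t‖) ?_ ?_ hwK.norm ?_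
    · exact Eventually.of_forall fun c => hwK.aestronglyMeasurable.mul
        (Complex.continuous_ofReal.comp (hφd c).continuous).aestronglyMeasurable
    · refine Eventually.of_forall fun c => ae_of_all _ fun t => ?_
      rw [norm_mul, Complex.norm_real]
      exact mul_le_of_le_one_right (norm_nonneg _) (hφbd c t)
    · refine ae_of_all _ fun t => tendsto_const_nhds.congr' ?_
      rcases lt_or_ge t x with h1 | h1
      · filter_upwards [eventually_ge_atTop (1 / (x - t)), eventually_gt_atTop 0] with c hc hc0
        rw [div_le_iff₀ (by linarith)] at hc
        rw [indicator_of_notMem (fun hh => absurd hh.1 (not_le.2 h1))]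
        simp only [φ, S]
        rw [Real.smoothTransition.one_of_one_le hc, Real.smoothTransition.one_of_one_le, sub_self]
        · simp
        · nlinarith
      rcases lt_or_ge t y with h2 | h2
      · filter_upwards [eventually_ge_atTop (1 / (y - t)), eventually_gt_atTop 0] with c hc hc0
        rw [div_le_iff₀ (by linarith)] at hc
        rw [indicator_of_mem (show t ∈ Ico x y from ⟨h1, h2⟩)]
        simp only [φ, S]
        rw [Real.smoothTransition.one_of_one_le hc, Real.smoothTransition.zero_of_nonpos]
        · simp
        · nlinarith
      · filter_upwards [eventually_gt_atTop 0] with c hc0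
        rw [indicator_of_notMem (fun hh => absurd hh.2 (not_lt.2 h2))]
        simp only [φ, S]
        rw [Real.smoothTransition.zero_of_nonpos, Real.smoothTransition.zero_of_nonpos, sub_self]
        · simp
        · nlinarith
        · nlinarith
  have hfinal := tendsto_nhds_unique
    (((hpeak x ⟨hax, hxy.trans hyb⟩).sub (hpeak y ⟨hax.trans hxy, hyb⟩)).congr' hweak) hlim.neg
  rw [setIntegral_indicator measurableSet_Ico,
    inter_eq_right.2 (Ico_subset_Icc_self.trans (Icc_subset_Icc hax.le hyb.le))] at hfinal
  linear_combination hfinal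

end WeakDeriv

end MetricGraph

/-! ### Sup bounds in terms of `L²` norms. -/

namespace MetricGraph

theorem integral_norm_mul_norm_le {α : Type*} [MeasurableSpace α] {μ : Measure α} {E F : Type*}
    [NormedAddCommGroup E] [NormedAddCommGroup F] {f : α → E} {g : α → F} (hf : MemLp f 2 μ)
    (hg : MemLp g 2 μ) :
    ∫ x, ‖f x‖ * ‖g x‖ ∂μ ≤ (eLpNorm f 2 μ).toReal * (eLpNorm g 2 μ).toReal := by
  have h2 : (2 : ℝ).HolderConjugate 2 := Real.HolderConjugate.two_two
  have h := integral_mul_norm_le_Lp_mul_Lq (μ := μ) (f := fun x => ‖f x‖) (g := fun x => ‖g x‖) h2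
    (by simpa using hf.norm) (by simpa using hg.norm)
  rw [hf.eLpNorm_eq_integral_rpow_norm two_ne_zero ENNReal.ofNat_ne_top,
    hg.eLpNorm_eq_integral_rpow_norm two_ne_zero ENNReal.ofNat_ne_top,
    ENNReal.toReal_ofReal (by positivity), ENNReal.toReal_ofReal (by positivity)]
  simpa using h

section Estimates

variable {I K : Set ℝ} {f w : ℝ → ℂ}

/-- The fundamental theorem of calculus gives the bound inside `K`. A compact convex set with
nonempty interior is the closure of that interior, so continuity of `f` carries the bound to the end
points. -/
theorem norm_sub_le_integral_norm_weakDeriv (hf : ContinuousOn f I)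
    (h : HasWeakDeriv (interior I) f w) (hK : IsCompact K) (hKc : Convex ℝ K) (hKI : K ⊆ I)
    (hne : (interior K).Nonempty) (hw : IntegrableOn w K) {x y : ℝ} (hx : x ∈ K) (hy : y ∈ K) :
    ‖f y - f x‖ ≤ ∫ t in K, ‖w t‖ := by
  have hcl : closure (interior K) = K := by
    rw [hKc.closure_interior_eq_closure_of_nonempty_interior hne, hK.isClosed.closure_eq]
  have hlt : ∀ x ∈ interior K, ∀ y ∈ interior K, x < y → ‖f y - f x‖ ≤ ∫ t in K, ‖w t‖ := by
    intro x hx y hy hxy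
    have hs : Icc x y ⊆ interior K := hKc.interior.ordConnected.out hx hy
    rw [← h.integral_eq_sub isOpen_interior (hf.mono interior_subset) hxy
      (hs.trans (interior_mono hKI))]
    refine (norm_integral_le_integral_norm _).trans ?_
    exact setIntegral_mono_set hw.norm (ae_of_all _ fun _ => norm_nonneg _)
      (Ico_subset_Icc_self.trans (hs.trans interior_subset)).eventuallyLE
  have hall : ∀ p ∈ interior K ×ˢ interior K, ‖f p.2 - f p.1‖ ≤ ∫ t in K, ‖w t‖ := by
    rintro ⟨x, y⟩ ⟨hx, hy⟩
    rcases lt_trichotomy x y with h1 | h1 | h1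
    · exact hlt x hx y hy h1
    · have h2 : x = y := h1
      subst h2
      rw [sub_self, norm_zero]
      exact integral_nonneg fun _ => norm_nonneg _
    · rw [norm_sub_rev]
      exact hlt y hy x hx h1
  have hfK : ContinuousOn f K := hf.mono hKI
  refine le_on_closure (f := fun p : ℝ × ℝ => ‖f p.2 - f p.1‖) hall ?_ continuousOn_const
    (x := (x, y)) ?_ <;> rw [closure_prod_eq, hcl]
  · exact ((hfK.comp continuousOn_snd fun p hp => hp.2).sub
      (hfK.comp continuousOn_fst fun p hp => hp.1)).norm
  · exact ⟨hx, hy⟩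

/-- Sup bound on a compact interval in terms of the `L²` norms of the function and of its magnetic
derivative. -/
theorem norm_le_of_hasWeakDeriv (hf : ContinuousOn f I)
    (h : HasWeakDeriv (interior I) f w) (hK : IsCompact K) (hKc : Convex ℝ K) (hKI : K ⊆ I)
    (hne : (interior K).Nonempty) {A : ℝ → ℝ} {D : ℝ → ℂ} (hA : MemLp A 2 (volume.restrict K))
    (hD : MemLp D 2 (volume.restrict K))
    (hwD : w =ᵐ[volume.restrict K] fun x => Complex.I * (D x + A x * f x)) {x : ℝ} (hx : x ∈ K) :
    ‖f x‖ ≤ ((eLpNorm (fun _ => (1 : ℝ)) 2 (volume.restrict K)).toReal / volume.real K +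
        (eLpNorm A 2 (volume.restrict K)).toReal) * (eLpNorm f 2 (volume.restrict K)).toReal +
      (eLpNorm (fun _ => (1 : ℝ)) 2 (volume.restrict K)).toReal *
        (eLpNorm D 2 (volume.restrict K)).toReal := by
  have hfin : IsFiniteMeasure (volume.restrict K) := ⟨by simpa using hK.measure_lt_top⟩
  have hone : MemLp (fun _ : ℝ => (1 : ℝ)) 2 (volume.restrict K) := memLp_const _
  have hfK : ContinuousOn f K := hf.mono hKI
  have hf2 : MemLp f 2 (volume.restrict K) := by
    obtain ⟨C, hC⟩ := hK.exists_bound_of_continuousOn hfK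
    refine MemLp.of_bound (hfK.aestronglyMeasurable hK.measurableSet) C ?_
    exact (ae_restrict_iff' hK.measurableSet).2 (ae_of_all _ hC)
  have hpos : 0 < volume.real K := by
    refine ENNReal.toReal_pos ?_ hK.measure_lt_top.ne
    exact (hne.mono subset_rfl |> fun h => (isOpen_interior.measure_pos volume h).trans_le
      (measure_mono interior_subset)).ne'
  have hDi : IntegrableOn D K := hD.integrable one_le_two
  have hAf : IntegrableOn (fun x => (A x : ℂ) * f x) K :=
    MemLp.integrable_mul (hA.ofReal (K := ℂ)) hf2
  have hwi : IntegrableOn w K := by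
    refine Integrable.congr ?_ hwD.symm
    exact (hDi.add hAf).const_mul _
  have hw1 : ∫ t in K, ‖w t‖ ≤ (eLpNorm (fun _ => (1 : ℝ)) 2 (volume.restrict K)).toReal *
        (eLpNorm D 2 (volume.restrict K)).toReal + (eLpNorm A 2 (volume.restrict K)).toReal *
        (eLpNorm f 2 (volume.restrict K)).toReal := by
    refine le_trans ?_ (add_le_add (integral_norm_mul_norm_le hone hD)
      (integral_norm_mul_norm_le hA hf2))
    have h1 : Integrable (fun x => ‖(1 : ℝ)‖ * ‖D x‖) (volume.restrict K) := by
      simpa using hDi.norm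
    have h2 : Integrable (fun x => ‖A x‖ * ‖f x‖) (volume.restrict K) := by
      simpa [norm_mul] using hAf.norm
    rw [← integral_add h1 h2]
    refine integral_mono_ae hwi.norm (h1.add h2) ?_
    filter_upwards [hwD] with t ht
    rw [ht, norm_mul, Complex.norm_I, one_mul]
    refine (norm_add_le _ _).trans (le_of_eq ?_)
    simp
  have hf1 : ∫ t in K, ‖f t‖ ≤ (eLpNorm (fun _ => (1 : ℝ)) 2 (volume.restrict K)).toReal *
        (eLpNorm f 2 (volume.restrict K)).toReal := by
    refine le_trans (le_of_eq ?_) (integral_norm_mul_norm_le hone hf2)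
    simp
  -- Average `‖f x‖ ≤ ‖f y‖ + ∫ ‖w‖` over `y ∈ K`.
  have hmean : volume.real K * ‖f x‖ ≤
      (∫ t in K, ‖f t‖) + volume.real K * ∫ t in K, ‖w t‖ := by
    have hfi : IntegrableOn (fun t => ‖f t‖) K := (hf2.integrable one_le_two).norm
    have hci : ∀ c : ℝ, IntegrableOn (fun _ : ℝ => c) K := fun c => integrable_const c
    have h1 : ∫ _ in K, ‖f x‖ ≤ ∫ t in K, (‖f t‖ + ∫ t in K, ‖w t‖) := by
      refine setIntegral_mono_on (hci _) (hfi.add (hci _)) hK.measurableSet fun y hy => ?_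
      have h2 := norm_sub_le_integral_norm_weakDeriv hf h hK hKc hKI hne hwi hy hx
      calc ‖f x‖ = ‖f y + (f x - f y)‖ := by rw [add_sub_cancel]
        _ ≤ ‖f y‖ + ‖f x - f y‖ := norm_add_le _ _
        _ ≤ _ := by linarith
    rw [integral_add hfi (hci _), setIntegral_const, setIntegral_const] at h1
    simpa using h1
  have h3 : ‖f x‖ ≤ (∫ t in K, ‖f t‖) / volume.real K + ∫ t in K, ‖w t‖ := by
    rw [← sub_le_iff_le_add, le_div_iff₀ hpos]
    linarith
  refine h3.trans ((add_le_add (div_le_div_of_nonneg_right hf1 hpos.le) hw1).trans (le_of_eq ?_))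
  ring

end Estimates

end MetricGraph

/-! ### The magnetic Sobolev space as a subspace of `L² × L²`. -/

namespace MetricGraph

variable {𝒱 ℰ : Type*} {G : MetricGraph 𝒱 ℰ}

/-- The family `g` of functions on the edges is a representative of the class `p ∈ L²(𝒢, ℂ)`. -/
def FamilyRepresents (g : ℰ → ℝ → ℂ) (p : G.L2) : Prop :=
  ∀ e, (p e : ℝ → ℂ) =ᵐ[volume.restrict (G.I e)] g e

theorem FamilyRepresents.add {g₁ g₂ : ℰ → ℝ → ℂ} {p₁ p₂ : G.L2} (h₁ : FamilyRepresents g₁ p₁)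
    (h₂ : FamilyRepresents g₂ p₂) : FamilyRepresents (fun e x => g₁ e x + g₂ e x) (p₁ + p₂) := by
  intro e
  rw [lp.coeFn_add, Pi.add_apply]
  filter_upwards [Lp.coeFn_add (p₁ e) (p₂ e), h₁ e, h₂ e] with x hx h1 h2
  rw [hx, Pi.add_apply, h1, h2]

theorem FamilyRepresents.const_mul {g : ℰ → ℝ → ℂ} {p : G.L2} (h : FamilyRepresents g p) (c : ℂ) :
    FamilyRepresents (fun e x => c * g e x) (c • p) := by
  intro e
  rw [lp.coeFn_smul, Pi.smul_apply]
  filter_upwards [Lp.coeFn_smul c (p e), h e] with x hx h1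
  rw [hx, Pi.smul_apply, h1, smul_eq_mul]

theorem familyRepresents_self (p : G.L2) : FamilyRepresents (fun e => p e) p :=
  fun _ => Filter.EventuallyEq.rfl

theorem familyRepresents_zero : FamilyRepresents (fun _ _ => 0) (0 : G.L2) := by
  intro e
  rw [lp.coeFn_zero, Pi.zero_apply]
  exact Lp.coeFn_zero _ _ _

theorem FamilyRepresents.congr {g₁ g₂ : ℰ → ℝ → ℂ} {p : G.L2} (h : FamilyRepresents g₁ p)
    (hg : ∀ e, g₁ e =ᵐ[volume.restrict (G.I e)] g₂ e) : FamilyRepresents g₂ p :=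
  fun e => (h e).trans (hg e)

theorem FamilyRepresents.eq {g : ℰ → ℝ → ℂ} {p₁ p₂ : G.L2} (h₁ : FamilyRepresents g p₁)
    (h₂ : FamilyRepresents g p₂) : p₁ = p₂ := by
  refine lp.ext (funext fun e => Lp.ext ?_)
  exact (h₁ e).trans (h₂ e).symm

theorem FamilyRepresents.memLpOn {g : ℰ → ℝ → ℂ} {p : G.L2} (h : FamilyRepresents g p) :
    G.MemLpOn 2 g univ := by
  refine ⟨fun e => ?_, ?_⟩
  · rw [edgePart_univ]
    exact (memLp_congr_ae (h e)).1 (Lp.memLp (p e))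
  · have h1 : ∀ e, eLpNorm (g e) 2 (volume.restrict (G.edgePart e univ)) ^ (2 : ℝ≥0∞).toReal =
        ‖p e‖ₑ ^ (2 : ℝ≥0∞).toReal := by
      intro e
      rw [edgePart_univ, ← eLpNorm_congr_ae (h e), Lp.enorm_def]
    simp_rw [h1]
    have h2 := (memℓp_gen_iff (by simp)).1 (lp.memℓp p)
    have h3 : ∀ e, ‖p e‖ₑ ^ (2 : ℝ≥0∞).toReal = ENNReal.ofReal (‖p e‖ ^ (2 : ℝ≥0∞).toReal) := by
      intro e
      rw [← ofReal_norm, ENNReal.ofReal_rpow_of_nonneg (norm_nonneg _) (by simp)]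
    simp_rw [h3]
    rw [← ENNReal.ofReal_tsum_of_nonneg (fun e => by positivity) h2]
    exact ENNReal.ofReal_lt_top

theorem MemLpOn.exists_familyRepresents {g : ℰ → ℝ → ℂ} (h : G.MemLpOn 2 g univ) :
    ∃ p : G.L2, FamilyRepresents g p := by
  have h1 : ∀ e, MemLp (g e) 2 (volume.restrict (G.I e)) := fun e => by
    simpa only [edgePart_univ] using h.1 e
  have h2 : Memℓp (fun e => (h1 e).toLp (g e)) 2 := by
    rw [memℓp_gen_iff (by simp)]
    have h3 : ∀ e, ‖(h1 e).toLp (g e)‖ ^ (2 : ℝ≥0∞).toReal =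
        (eLpNorm (g e) 2 (volume.restrict (G.edgePart e univ)) ^ (2 : ℝ≥0∞).toReal).toReal := by
      intro e
      rw [edgePart_univ, Lp.norm_toLp, ENNReal.toReal_rpow]
    simp_rw [h3]
    exact ENNReal.summable_toReal h.2.ne
  exact ⟨⟨_, h2⟩, fun e => (h1 e).coeFn_toLp⟩

theorem FamilyRepresents.hasSum_inner {f g : ℰ → ℝ → ℂ} {p q : G.L2} (hf : FamilyRepresents f p)
    (hg : FamilyRepresents g q) :
    HasSum (fun e => ∫ x in G.I e, g e x * conj (f e x)) (inner ℂ p q) := by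
  refine (lp.hasSum_inner p q).congr_fun fun e => ?_
  rw [L2.inner_def]
  refine integral_congr_ae ?_
  filter_upwards [hf e, hg e] with x h1 h2
  rw [h1, h2, RCLike.inner_apply]

theorem FamilyRepresents.integrable {f g : ℰ → ℝ → ℂ} {p q : G.L2} (hf : FamilyRepresents f p)
    (hg : FamilyRepresents g q) (e : ℰ) :
    Integrable (fun x => g e x * conj (f e x)) (volume.restrict (G.I e)) := by
  refine (L2.integrable_inner (𝕜 := ℂ) (p e) (q e)).congr ?_
  filter_upwards [hf e, hg e] with x h1 h2
  rw [h1, h2, RCLike.inner_apply]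

/-- `p = (√V f, D_A f)` in `L² × L²`, for a continuous function `f` with `D_A f` in the weak
sense. -/
structure IsFormElement (A V : ℰ → ℝ → ℝ) (f : G.Point → ℂ) (p : WithLp 2 (G.L2 × G.L2)) :
    Prop where
  continuous : Continuous f
  hasWeakDeriv : ∀ e, HasWeakDeriv (interior (G.I e)) (G.onEdges f e)
    (fun x => Complex.I * (p.snd e x + A e x * G.onEdges f e x))
  represents : FamilyRepresents (fun e x => (√(V e x) : ℂ) * G.onEdges f e x) p.fst

section Form

variable {A V : ℰ → ℝ → ℝ} {f g : G.Point → ℂ} {p q : WithLp 2 (G.L2 × G.L2)}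

theorem IsFormElement.add (hf : IsFormElement A V f p) (hg : IsFormElement A V g q) :
    IsFormElement A V (f + g) (p + q) where
  continuous := hf.continuous.add hg.continuous
  hasWeakDeriv e := by
    refine ((hf.hasWeakDeriv e).add isOpen_interior (hg.hasWeakDeriv e)).congr_deriv ?_
    rw [restrict_interior_I]
    filter_upwards [(familyRepresents_self p.snd).add (familyRepresents_self q.snd) e] with x hx
    rw [WithLp.add_snd, hx]
    simp only [Pi.add_apply, onEdges]
    ring
  represents := (hf.represents.add hg.represents).congr fun e => ae_of_all _ fun x => by
    simp only [onEdges, Pi.add_apply]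
    ring

theorem IsFormElement.const_smul (hf : IsFormElement A V f p) (c : ℂ) :
    IsFormElement A V (c • f) (c • p) where
  continuous := hf.continuous.const_smul c
  hasWeakDeriv e := by
    refine ((hf.hasWeakDeriv e).const_mul c).congr_deriv ?_
    rw [restrict_interior_I]
    filter_upwards [(familyRepresents_self p.snd).const_mul c e] with x hx
    rw [WithLp.smul_snd, hx]
    simp only [Pi.smul_apply, onEdges, smul_eq_mul]
    ring
  represents := (hf.represents.const_mul c).congr fun e => ae_of_all _ fun x => by
    simp only [onEdges, Pi.smul_apply, smul_eq_mul]
    ring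

theorem isFormElement_zero : IsFormElement A V (0 : G.Point → ℂ) 0 where
  continuous := continuous_zero
  hasWeakDeriv e := by
    have h0 : HasWeakDeriv (interior (G.I e)) (0 : ℝ → ℂ) 0 :=
      ⟨locallyIntegrableOn_zero, locallyIntegrableOn_zero, fun φ _ _ _ => by simp⟩
    refine h0.congr_deriv ?_
    rw [restrict_interior_I]
    filter_upwards [familyRepresents_zero e] with x hx
    rw [WithLp.zero_snd, hx]
    simp [onEdges]
  represents := familyRepresents_zero.congr fun e => ae_of_all _ fun x => by simp [onEdges]

theorem IsFormElement.sub (hf : IsFormElement A V f p) (hg : IsFormElement A V g q) :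
    IsFormElement A V (f - g) (p - q) := by
  simpa only [sub_eq_add_neg, neg_one_smul] using hf.add (hg.const_smul (-1))

theorem IsFormElement.familyRepresents_magD (hf : IsFormElement A V f p) :
    FamilyRepresents (G.magD A f) p.snd := by
  intro e
  have h := (hf.hasWeakDeriv e).weakDeriv_ae_eq isOpen_interior
  rw [restrict_interior_I] at h
  filter_upwards [h] with x hx
  unfold magD
  rw [hx, ← mul_assoc, one_div, inv_mul_cancel₀ Complex.I_ne_zero]
  ring

theorem eLpNorm_sqrt_mul_rpow {μ : Measure ℝ} {v : ℝ → ℝ} (hv : ∀ᵐ x ∂μ, 0 ≤ v x) (u : ℝ → ℂ) :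
    eLpNorm (fun x => (√(v x) : ℂ) * u x) 2 μ ^ (2 : ℝ≥0∞).toReal =
      ∫⁻ x, ENNReal.ofReal (v x * ‖u x‖ ^ 2) ∂μ := by
  rw [eLpNorm_eq_lintegral_rpow_enorm_toReal two_ne_zero ENNReal.ofNat_ne_top, ← ENNReal.rpow_mul,
    one_div, inv_mul_cancel₀ (by simp), ENNReal.rpow_one]
  refine lintegral_congr_ae ?_
  filter_upwards [hv] with x hx
  rw [← ofReal_norm, ENNReal.ofReal_rpow_of_nonneg (norm_nonneg _) (by simp)]
  congr 1
  rw [norm_mul, Complex.norm_real, Real.norm_of_nonneg (Real.sqrt_nonneg _)]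
  simp [mul_pow, Real.sq_sqrt hx]

theorem ae_nonneg_potential (hV1 : ∀ e, ∀ x ∈ G.I e, 1 ≤ V e x) (e : ℰ) :
    ∀ᵐ x ∂volume.restrict (G.I e), 0 ≤ V e x :=
  (ae_restrict_iff' (G.measurableSet_I e)).2
    (ae_of_all _ fun x hx => zero_le_one.trans (hV1 e x hx))

/-- Here `p` collects the classes of `√V f` and `D_A f`. Solving `D_A f = -i f' - A f` for `f'`
exchanges the chosen `weakDeriv` for the relation in `IsFormElement`. -/
theorem mem_H1A_iff (hV : G.MemLpLoc 1 V) (hV1 : ∀ e, ∀ x ∈ G.I e, 1 ≤ V e x) :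
    f ∈ G.H1A A V ↔ ∃ p, IsFormElement A V f p := by
  have hnorm : ∀ f : G.Point → ℂ, (∑' e, eLpNorm (fun x => (√(V e x) : ℂ) * G.onEdges f e x) 2
      (volume.restrict (G.edgePart e univ)) ^ (2 : ℝ≥0∞).toReal) =
      ∑' e, ∫⁻ x in G.I e, ENNReal.ofReal (V e x * ‖G.onEdges f e x‖ ^ 2) := fun f =>
    tsum_congr fun e => by
      rw [edgePart_univ, eLpNorm_sqrt_mul_rpow (ae_nonneg_potential hV1 e)]
  constructor
  · rintro ⟨hc, hw, hD, hVf⟩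
    rw [← hnorm] at hVf
    obtain ⟨b, hb⟩ := hD.exists_familyRepresents
    have hm : G.MemLpOn 2 (fun e x => (√(V e x) : ℂ) * G.onEdges f e x) univ := by
      refine ⟨fun e => ⟨?_, ?_⟩, hVf⟩
      · rw [edgePart_univ]
        refine AEStronglyMeasurable.mul ?_
          ((continuousOn_onEdges hc e).aestronglyMeasurable (G.measurableSet_I e))
        exact (Complex.continuous_ofReal.comp Real.continuous_sqrt).comp_aestronglyMeasurable
          (hV.aestronglyMeasurable e)
      · have := ENNReal.lt_top_of_tsum_ne_top hVf.ne e
        by_contra hcon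
        rw [not_lt_top_iff.1 hcon] at this
        simp at this
    obtain ⟨a, ha⟩ := hm.exists_familyRepresents
    refine ⟨WithLp.toLp 2 (a, b), hc, fun e => ?_, ha⟩
    refine (hasWeakDeriv_weakDeriv (hw e)).congr_deriv ?_
    rw [restrict_interior_I]
    filter_upwards [hb e] with x hx
    change _ = Complex.I * (b e x + _)
    rw [hx]
    unfold magD
    rw [sub_add_cancel, ← mul_assoc, one_div, mul_inv_cancel₀ Complex.I_ne_zero, one_mul]
  · rintro ⟨p, hp⟩
    refine ⟨hp.continuous, fun e => ⟨_, hp.hasWeakDeriv e⟩, hp.familyRepresents_magD.memLpOn, ?_⟩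
    rw [← hnorm]
    exact hp.represents.memLpOn.2

/-- `Q` is conjugate-linear in its second argument and `inner` in its first, hence the reversed
order. The potential term is split as `√V · √V`. -/
theorem IsFormElement.Q_eq_inner (hV1 : ∀ e, ∀ x ∈ G.I e, 1 ≤ V e x)
    (hf : IsFormElement A V f p) (hg : IsFormElement A V g q) :
    G.Q A V f g = inner ℂ q p := by
  rw [WithLp.prod_inner_apply]
  have h1 := hg.represents.hasSum_inner hf.represents
  have h2 := hg.familyRepresents_magD.hasSum_inner hf.familyRepresents_magD
  refine Eq.trans ?_ (h1.add h2).tsum_eq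
  unfold Q integral
  refine tsum_congr fun e => ?_
  rw [← integral_add (hg.represents.integrable hf.represents e)
    (hg.familyRepresents_magD.integrable hf.familyRepresents_magD e)]
  refine integral_congr_ae ?_
  filter_upwards [ae_nonneg_potential hV1 e] with x hx
  simp only [map_mul, Complex.conj_ofReal]
  have : (V e x : ℂ) = (√(V e x) : ℂ) * √(V e x) := by
    rw [← Complex.ofReal_mul, Real.mul_self_sqrt hx]
  rw [this]
  ring

end Form

/-! ### Sup bounds along the edges and the embedding into `L²`. -/

section Bounds

variable {A V : ℰ → ℝ → ℝ} {f g : G.Point → ℂ} {p q : WithLp 2 (G.L2 × G.L2)}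

theorem norm_le_norm_sqrt_mul (hV1 : ∀ e, ∀ x ∈ G.I e, 1 ≤ V e x) (e : ℰ) (u : ℝ → ℂ) :
    ∀ᵐ x ∂volume.restrict (G.I e), ‖u x‖ ≤ ‖(√(V e x) : ℂ) * u x‖ := by
  refine (ae_restrict_iff' (G.measurableSet_I e)).2 (ae_of_all _ fun x hx => ?_)
  rw [norm_mul, Complex.norm_real, Real.norm_of_nonneg (Real.sqrt_nonneg _)]
  exact le_mul_of_one_le_left (norm_nonneg _) (Real.one_le_sqrt.2 (hV1 e x hx))

theorem toReal_eLpNorm_le {e : ℰ} {K : Set ℝ} (hK : K ⊆ G.I e) {P : G.L2} {u : ℝ → ℂ}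
    (hu : ∀ᵐ x ∂volume.restrict (G.I e), ‖u x‖ ≤ ‖P e x‖) :
    (eLpNorm u 2 (volume.restrict K)).toReal ≤ ‖P‖ := by
  refine le_trans ?_ (lp.norm_apply_le_norm two_ne_zero P e)
  rw [Lp.norm_def]
  refine ENNReal.toReal_mono (Lp.eLpNorm_ne_top _) ?_
  exact (eLpNorm_mono_measure _ (Measure.restrict_mono_set _ hK)).trans (eLpNorm_mono_ae hu)

/-- The shift to `n + 1` avoids the degenerate interval `Icc 0 0`. -/
theorem nonempty_interior_I_inter (e : ℰ) (n : ℕ) :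
    (interior (G.I e ∩ Icc 0 ((n + 1 : ℕ) : ℝ))).Nonempty := by
  obtain ⟨l, hl, h⟩ := G.exists_Icc_subset_I e
  have hn : (0 : ℝ) < ((n + 1 : ℕ) : ℝ) := by positivity
  refine ⟨min l ((n + 1 : ℕ) : ℝ) / 2, ?_⟩
  rw [interior_inter, interior_Icc]
  have hpos : 0 < min l ((n + 1 : ℕ) : ℝ) := lt_min hl hn
  refine ⟨interior_mono h ?_, by linarith, ?_⟩
  · rw [interior_Icc]
    exact ⟨by linarith, by linarith [min_le_left l ((n + 1 : ℕ) : ℝ)]⟩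
  · linarith [min_le_right l ((n + 1 : ℕ) : ℝ)]

/-- On bounded parts of an edge, the form norm controls the sup norm. -/
theorem exists_norm_le (hA : G.MemLpLoc 2 A) (hV1 : ∀ e, ∀ x ∈ G.I e, 1 ≤ V e x) (e : ℰ) (n : ℕ) :
    ∃ C : ℝ, 0 ≤ C ∧ ∀ f p, IsFormElement A V f p →
      ∀ x ∈ G.I e ∩ Icc 0 (n : ℝ), ‖G.onEdges f e x‖ ≤ C * ‖p‖ := by
  let K := G.I e ∩ Icc 0 ((n + 1 : ℕ) : ℝ)
  let N := (eLpNorm (fun _ => (1 : ℝ)) 2 (volume.restrict K)).toReal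
  let M := (eLpNorm (A e) 2 (volume.restrict K)).toReal
  have hM : 0 ≤ N / volume.real K + M := by positivity
  -- The `L²` norms of `f` and of `D_A f` on `K` are both at most `‖p‖`, so the two coefficients of
  -- the sup bound add up.
  refine ⟨N / volume.real K + M + N, by positivity, fun f p h x hx => ?_⟩
  have hKI : K ⊆ G.I e := inter_subset_left
  have hx' : x ∈ K := ⟨hx.1, hx.2.1, hx.2.2.trans (by simp)⟩
  have hμ : volume.restrict K ≤ volume.restrict (G.I e) := Measure.restrict_mono_set _ hKI
  have h1 := norm_le_of_hasWeakDeriv (K := K) (continuousOn_onEdges h.continuous e)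
    (h.hasWeakDeriv e) (isCompact_I_inter e (n + 1)) (convex_I_inter e (n + 1)) hKI
    (nonempty_interior_I_inter e n) (hA.memLp e (n + 1))
    ((Lp.memLp (p.snd e)).mono_measure hμ) (ae_of_all _ fun _ => rfl) hx'
  have h2 : (eLpNorm (G.onEdges f e) 2 (volume.restrict K)).toReal ≤ ‖p‖ := by
    refine (toReal_eLpNorm_le (P := p.fst) hKI ?_).trans (WithLp.norm_fst_le _ _)
    filter_upwards [h.represents e, norm_le_norm_sqrt_mul hV1 e (G.onEdges f e)] with x hx hx'
    rwa [hx]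
  have h3 : (eLpNorm (p.snd e) 2 (volume.restrict K)).toReal ≤ ‖p‖ :=
    (toReal_eLpNorm_le (P := p.snd) hKI (ae_of_all _ fun _ => le_rfl)).trans (WithLp.norm_snd_le _ _)
  refine h1.trans ?_
  rw [add_mul (N / volume.real K + M)]
  exact add_le_add (mul_le_mul_of_nonneg_left h2 hM)
    (mul_le_mul_of_nonneg_left h3 ENNReal.toReal_nonneg)

/-- The pairs `(√V f, D_A f)`, for `f` in the magnetic Sobolev space. -/
def formSpace (G : MetricGraph 𝒱 ℰ) (A V : ℰ → ℝ → ℝ) : Submodule ℂ (WithLp 2 (G.L2 × G.L2)) where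
  carrier := {p | ∃ f, IsFormElement A V f p}
  zero_mem' := ⟨0, isFormElement_zero⟩
  add_mem' := by
    rintro p q ⟨f, hf⟩ ⟨g, hg⟩
    exact ⟨f + g, hf.add hg⟩
  smul_mem' := by
    rintro c p ⟨f, hf⟩
    exact ⟨c • f, hf.const_smul c⟩

theorem MemLpOn.mono {g g' : ℰ → ℝ → ℂ} (h : G.MemLpOn 2 g univ)
    (hm : ∀ e, AEStronglyMeasurable (g' e) (volume.restrict (G.I e)))
    (hle : ∀ e, ∀ᵐ x ∂volume.restrict (G.I e), ‖g' e x‖ ≤ ‖g e x‖) : G.MemLpOn 2 g' univ := by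
  refine ⟨fun e => ?_, lt_of_le_of_lt (ENNReal.tsum_le_tsum fun e => ?_) h.2⟩
  · have := h.1 e
    rw [edgePart_univ] at this ⊢
    exact this.of_le (hm e) (hle e)
  · rw [edgePart_univ]
    exact ENNReal.rpow_le_rpow (eLpNorm_mono_ae (hle e)) (by simp)

/-- Division by `√V ≥ 1`. It makes the embedding independent of the choice of `f`, hence linear. -/
theorem FamilyRepresents.eq_of_sqrt_mul (hV1 : ∀ e, ∀ x ∈ G.I e, 1 ≤ V e x) {u v P : G.L2}
    (hu : FamilyRepresents (fun e x => (√(V e x) : ℂ) * u e x) P)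
    (hv : FamilyRepresents (fun e x => (√(V e x) : ℂ) * v e x) P) : u = v := by
  refine (familyRepresents_self u).eq fun e => ?_
  have h1 : ∀ᵐ x ∂volume.restrict (G.I e), 1 ≤ V e x :=
    (ae_restrict_iff' (G.measurableSet_I e)).2 (ae_of_all _ (hV1 e))
  filter_upwards [hu e, hv e, h1] with x h2 h3 h4
  have h5 : (√(V e x) : ℂ) ≠ 0 := by
    have : 0 < √(V e x) := Real.sqrt_pos.2 (zero_lt_one.trans_le h4)
    exact_mod_cast this.ne'
  exact mul_left_cancel₀ h5 (h3.symm.trans h2)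

theorem IsFormElement.exists_familyRepresents (hV1 : ∀ e, ∀ x ∈ G.I e, 1 ≤ V e x)
    (h : IsFormElement A V f p) : ∃ u : G.L2, FamilyRepresents (G.onEdges f) u :=
  (h.represents.memLpOn.mono
    (fun e => (continuousOn_onEdges h.continuous e).aestronglyMeasurable (G.measurableSet_I e))
    fun e => norm_le_norm_sqrt_mul hV1 e _).exists_familyRepresents

/-- The embedding `(√V f, D_A f) ↦ f` of the form space into `L²`. -/
theorem exists_embedding (hV1 : ∀ e, ∀ x ∈ G.I e, 1 ≤ V e x) :
    ∃ J : formSpace G A V →L[ℂ] G.L2,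
      ∀ (p : formSpace G A V) f, IsFormElement A V f p → FamilyRepresents (G.onEdges f) (J p) := by
  have hR : ∀ {f p} {u : G.L2}, IsFormElement A V f p → FamilyRepresents (G.onEdges f) u →
      FamilyRepresents (fun e x => (√(V e x) : ℂ) * u e x) p.fst := by
    intro f p u hf hu
    refine hf.represents.congr fun e => ?_
    filter_upwards [hu e] with x hx
    rw [hx]
  have hex : ∀ p : formSpace G A V, ∃ u : G.L2,
      FamilyRepresents (fun e x => (√(V e x) : ℂ) * u e x) p.1.fst := by
    rintro ⟨p, f, hf⟩
    obtain ⟨u, hu⟩ := hf.exists_familyRepresents hV1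
    exact ⟨u, hR hf hu⟩
  choose J hJ using hex
  let J' : formSpace G A V →ₗ[ℂ] G.L2 :=
    { toFun := J
      map_add' := by
        intro p q
        refine FamilyRepresents.eq_of_sqrt_mul hV1 (hJ (p + q)) ?_
        refine ((hJ p).add (hJ q)).congr fun e => ?_
        filter_upwards [(familyRepresents_self (J p)).add (familyRepresents_self (J q)) e] with x hx
        rw [hx, mul_add]
      map_smul' := by
        intro c p
        refine FamilyRepresents.eq_of_sqrt_mul hV1 (hJ (c • p)) ?_
        refine ((hJ p).const_mul c).congr fun e => ?_
        filter_upwards [(familyRepresents_self (J p)).const_mul c e] with x hx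
        rw [RingHom.id_apply, hx]
        ring }
  refine ⟨J'.mkContinuous 1 fun p => ?_, fun p f hf => ?_⟩
  · rw [one_mul]
    refine le_trans ?_ (WithLp.norm_fst_le _ (p : WithLp 2 (G.L2 × G.L2)))
    refine lp.norm_mono two_ne_zero fun e => ?_
    refine Lp.norm_le_norm_of_ae_le ?_
    filter_upwards [hJ p e, norm_le_norm_sqrt_mul hV1 e (J p e)] with x h1 h2
    rwa [h1]
  · obtain ⟨u, hu⟩ := hf.exists_familyRepresents hV1
    have : J p = u := FamilyRepresents.eq_of_sqrt_mul hV1 (hJ p) (hR hf hu)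
    change FamilyRepresents _ (J p)
    rwa [this]

/-- A form element whose function vanishes in `L²` is zero. -/
theorem IsFormElement.eq_zero (h : IsFormElement A V f p)
    (h0 : FamilyRepresents (G.onEdges f) (0 : G.L2)) : p = 0 := by
  have hz : ∀ e, G.onEdges f e =ᵐ[volume.restrict (G.I e)] fun _ => 0 := fun e =>
    (h0 e).symm.trans (familyRepresents_zero e)
  have h1 : p.fst = 0 := h.represents.eq (familyRepresents_zero.congr fun e => by
    filter_upwards [hz e] with x hx
    rw [hx, mul_zero])
  have h2 : p.snd = 0 := (familyRepresents_self p.snd).eq (familyRepresents_zero.congr fun e => by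
    -- A function that vanishes a.e. has weak derivative `0`. Uniqueness then gives `i (D + A f) =
    -- 0`, and so `D = 0`.
    have hw : HasWeakDeriv (interior (G.I e)) (G.onEdges f e) 0 := by
      refine ⟨(h.hasWeakDeriv e).1, locallyIntegrableOn_zero, fun φ _ _ _ => ?_⟩
      rw [integral_eq_zero_of_ae]
      · simp
      · rw [restrict_interior_I]
        filter_upwards [hz e] with x hx
        rw [hx, zero_mul, Pi.zero_apply]
    have := (h.hasWeakDeriv e).ae_eq isOpen_interior hw
    rw [restrict_interior_I] at this
    filter_upwards [this, hz e] with x hx hx'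
    simpa [hx', eq_comm] using hx)
  exact WithLp.ofLp_injective 2 (Prod.ext h1 h2)

end Bounds

/-! ### Closedness of the form space. -/

section Closed

open Filter Topology

variable {A V : ℰ → ℝ → ℝ} {f g : G.Point → ℂ} {p q : WithLp 2 (G.L2 × G.L2)}

theorem integrableOn_potential_mul (hA : G.MemLpLoc 2 A) {e : ℰ} {n : ℕ} {u : ℝ → ℂ}
    (hu : ContinuousOn u (G.I e)) :
    IntegrableOn (fun x => (A e x : ℂ) * u x) (G.I e ∩ Icc 0 (n : ℝ)) := by
  have hK := isCompact_I_inter (G := G) e n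
  have : IsFiniteMeasure (volume.restrict (G.I e ∩ Icc 0 (n : ℝ))) :=
    ⟨by simpa using hK.measure_lt_top⟩
  have h1 : IntegrableOn (fun x => (A e x : ℂ)) (G.I e ∩ Icc 0 (n : ℝ)) :=
    ((hA.memLp e n).integrable one_le_two).ofReal
  exact h1.mul_continuousOn (hu.mono inter_subset_left) hK

theorem locallyIntegrableOn_interior_I {e : ℰ} {w : ℝ → ℂ}
    (h : ∀ n : ℕ, IntegrableOn w (G.I e ∩ Icc 0 (n : ℝ))) :
    LocallyIntegrableOn w (interior (G.I e)) := by
  rw [locallyIntegrableOn_iff isOpen_interior.isLocallyClosed]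
  intro K hKI hK
  obtain ⟨n, hn⟩ := exists_subset_I_inter hK (hKI.trans interior_subset)
  exact (h n).mono_set hn

theorem integrableOn_L2_apply (P : G.L2) (e : ℰ) (n : ℕ) :
    IntegrableOn (P e) (G.I e ∩ Icc 0 (n : ℝ)) := by
  have hK := isCompact_I_inter (G := G) e n
  have : IsFiniteMeasure (volume.restrict (G.I e ∩ Icc 0 (n : ℝ))) :=
    ⟨by simpa using hK.measure_lt_top⟩
  exact ((Lp.memLp (P e)).mono_measure (Measure.restrict_mono_set _ inter_subset_left)).integrable
    one_le_two

/-- The form elements with limit in `L² × L²` converge uniformly on bounded parts of the edges. -/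
theorem exists_limit_function (hconn : G.Connected) (hA : G.MemLpLoc 2 A)
    (hV1 : ∀ e, ∀ x ∈ G.I e, 1 ≤ V e x) (e₀ : ℰ) {P : ℕ → WithLp 2 (G.L2 × G.L2)}
    {F : ℕ → G.Point → ℂ} (hF : ∀ k, IsFormElement A V (F k) (P k))
    (hP : Tendsto P atTop (𝓝 p)) :
    ∃ f : G.Point → ℂ, ∀ (e : ℰ) (n : ℕ), ∃ C, 0 ≤ C ∧ ∀ x ∈ G.I e ∩ Icc 0 (n : ℝ), ∀ k,
      ‖G.onEdges (F k) e x - G.onEdges f e x‖ ≤ C * ‖P k - p‖ := by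
  have hlim : ∀ r : G.Point, ∃ c : ℂ, Tendsto (fun k => F k r) atTop (𝓝 c) := by
    intro r
    obtain ⟨e, x, hx, rfl⟩ := exists_pt_eq hconn e₀ r
    obtain ⟨n, hn⟩ := exists_nat_ge x
    obtain ⟨C, -, hC⟩ := exists_norm_le hA hV1 e n
    refine cauchySeq_tendsto_of_complete (cauchySeq_iff_tendsto_dist_atTop_0.2 ?_)
    have h1 := (cauchySeq_iff_tendsto_dist_atTop_0.1 hP.cauchySeq).const_mul C
    rw [mul_zero] at h1
    refine squeeze_zero (fun _ => dist_nonneg) (fun k => ?_) h1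
    rw [dist_eq_norm, dist_eq_norm]
    exact hC _ _ ((hF k.1).sub (hF k.2)) x ⟨hx, hx.1, hn⟩
  choose f hf using hlim
  refine ⟨f, fun e n => ?_⟩
  obtain ⟨C, hC0, hC⟩ := exists_norm_le hA hV1 e n
  refine ⟨C, hC0, fun x hx k => ?_⟩
  -- Let `l → ∞` in the sup bound for `F k - F l`.
  refine le_of_tendsto_of_tendsto' ((tendsto_const_nhds.sub (hf (G.pt e x))).norm)
    ((tendsto_const_nhds.sub hP).norm.const_mul C) fun l => ?_
  exact hC _ _ ((hF k).sub (hF l)) x hx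

/-- The constants depend on the edge. A unit ball meets finitely many edges, each in a bounded range
of coordinates, so the sum of finitely many constants gives uniform convergence there. -/
theorem continuous_of_locally_uniform_limit (hconn : G.Connected) (hlf : G.LocallyFinite) (e₀ : ℰ)
    {ε : ℕ → ℝ} (hε : Tendsto ε atTop (𝓝 0)) (hε0 : ∀ k, 0 ≤ ε k) {F : ℕ → G.Point → ℂ}
    (hF : ∀ k, Continuous (F k))
    (h : ∀ (e : ℰ) (n : ℕ), ∃ C, 0 ≤ C ∧ ∀ x ∈ G.I e ∩ Icc 0 (n : ℝ), ∀ k,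
      ‖G.onEdges (F k) e x - G.onEdges f e x‖ ≤ C * ε k) : Continuous f := by
  choose C hC0 hC using h
  refine continuous_iff_continuousAt.2 fun r => ?_
  have hball : Metric.eball r 1 ∈ 𝓝 r := Metric.eball_mem_nhds r one_pos
  refine ContinuousOn.continuousAt ?_ hball
  choose n hn using fun e => exists_edgePart_ball_subset hconn e r
  have hfin := hlf.2 _ (bounded_ball r)
  have hunif : TendstoUniformlyOn F f atTop (Metric.eball r 1) := by
    rw [Metric.tendstoUniformlyOn_iff]
    intro δ hδ
    have h1 : Tendsto (fun k => (∑ e ∈ hfin.toFinset, C e (n e)) * ε k) atTop (𝓝 0) := by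
      simpa using hε.const_mul (∑ e ∈ hfin.toFinset, C e (n e))
    filter_upwards [h1.eventually (gt_mem_nhds hδ)] with k hk q hq
    obtain ⟨e, x, hx, rfl⟩ := exists_pt_eq hconn e₀ q
    have he : e ∈ hfin.toFinset := by
      rw [Set.Finite.mem_toFinset]
      exact ⟨x, hx, hq⟩
    rw [dist_comm, dist_eq_norm]
    refine lt_of_le_of_lt (hC e (n e) x ⟨hx, hn e ⟨hx, hq⟩⟩ k) (lt_of_le_of_lt ?_ hk)
    exact mul_le_mul_of_nonneg_right
      (Finset.single_le_sum (f := fun e => C e (n e)) (fun e _ => hC0 e (n e)) he) (hε0 k)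
  exact hunif.continuousOn (Frequently.of_forall fun k => (hF k).continuousOn)

theorem tendsto_L2_apply {P : ℕ → G.L2} {Q : G.L2} (h : Tendsto P atTop (𝓝 Q)) (e : ℰ) :
    Tendsto (fun k => P k e) atTop (𝓝 (Q e)) := by
  rw [tendsto_iff_norm_sub_tendsto_zero] at h ⊢
  refine squeeze_zero (fun _ => norm_nonneg _) (fun k => ?_) h
  exact lp.norm_apply_le_norm two_ne_zero (P k - Q) e

/-- The weak derivative passes to the limit. -/
theorem hasWeakDeriv_limit (hA : G.MemLpLoc 2 A) {P : ℕ → G.L2} {Q : G.L2}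
    (hP : Tendsto P atTop (𝓝 Q)) {ε : ℕ → ℝ} (hε : Tendsto ε atTop (𝓝 0))
    {F : ℕ → G.Point → ℂ} (hf : Continuous f)
    (h : ∀ (e : ℰ) (n : ℕ), ∃ C, 0 ≤ C ∧ ∀ x ∈ G.I e ∩ Icc 0 (n : ℝ), ∀ k,
      ‖G.onEdges (F k) e x - G.onEdges f e x‖ ≤ C * ε k) (hF : ∀ k, Continuous (F k)) (e : ℰ)
    (hFd : ∀ k, HasWeakDeriv (interior (G.I e)) (G.onEdges (F k) e)
      (fun x => Complex.I * (P k e x + A e x * G.onEdges (F k) e x))) :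
    HasWeakDeriv (interior (G.I e)) (G.onEdges f e)
      (fun x => Complex.I * (Q e x + A e x * G.onEdges f e x)) := by
  have hfe := continuousOn_onEdges hf e
  refine ⟨(hfe.mono interior_subset).locallyIntegrableOn measurableSet_interior,
    locallyIntegrableOn_interior_I fun n => ((integrableOn_L2_apply Q e n).add
      (integrableOn_potential_mul hA hfe)).const_mul _, fun φ hφ hc hs => ?_⟩
  obtain ⟨n, hn⟩ := exists_subset_I_inter hc (hs.trans interior_subset)
  let K := G.I e ∩ Icc 0 (n : ℝ)
  have hK : IsCompact K := isCompact_I_inter e n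
  have hKI : K ⊆ G.I e := inter_subset_left
  have hz : ∀ x, x ∉ K → φ x = 0 := fun x hx =>
    image_eq_zero_of_notMem_tsupport fun hh => hx (hn hh)
  have hz' : ∀ x, x ∉ K → deriv φ x = 0 := fun x hx =>
    Function.notMem_support.1 fun hh => hx (hn (support_deriv_subset hh))
  have hd : Continuous (deriv φ) := hφ.continuous_deriv (by simp)
  have hred : ∀ u : ℝ → ℂ, (∀ x, x ∉ K → u x = 0) →
      ∫ x in interior (G.I e), u x = ∫ x in K, u x := by
    intro u hu
    rw [restrict_interior_I]
    exact setIntegral_eq_of_subset_of_forall_sdiff_eq_zero (G.measurableSet_I e) hKI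
      fun x hx => hu x hx.2
  obtain ⟨C, hC0, hC⟩ := h e n
  -- Uniform convergence on `K` needs only an integrable weight, which covers both `ψ = φ'` and `ψ =
  -- A φ`.
  have hlim : ∀ ψ : ℝ → ℂ, IntegrableOn ψ K →
      Tendsto (fun k => ∫ x in K, ψ x * G.onEdges (F k) e x) atTop
        (𝓝 (∫ x in K, ψ x * G.onEdges f e x)) := by
    intro ψ hψ
    obtain ⟨M, hM⟩ := hK.exists_bound_of_continuousOn (hfe.mono hKI)
    obtain ⟨B, hB⟩ := hε.bddAbove_range
    refine tendsto_integral_of_dominated_convergence (fun x => ‖ψ x‖ * (C * B + M)) ?_ ?_ ?_ ?_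
    · exact fun k => hψ.aestronglyMeasurable.mul
        (((continuousOn_onEdges (hF k) e).mono hKI).aestronglyMeasurable hK.measurableSet)
    · exact hψ.norm.mul_const _
    · intro k
      refine (ae_restrict_iff' hK.measurableSet).2 (ae_of_all _ fun x hx => ?_)
      rw [norm_mul]
      refine mul_le_mul_of_nonneg_left ?_ (norm_nonneg _)
      calc ‖G.onEdges (F k) e x‖
          = ‖(G.onEdges (F k) e x - G.onEdges f e x) + G.onEdges f e x‖ := by rw [sub_add_cancel]
        _ ≤ _ := (norm_add_le _ _).trans (add_le_add ((hC x hx k).trans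
          (mul_le_mul_of_nonneg_left (hB (mem_range_self k)) hC0)) (hM x hx))
    · refine (ae_restrict_iff' hK.measurableSet).2 (ae_of_all _ fun x hx => ?_)
      refine Tendsto.const_mul _ ?_
      rw [tendsto_iff_norm_sub_tendsto_zero]
      refine squeeze_zero (fun _ => norm_nonneg _) (hC x hx) ?_
      simpa using hε.const_mul C
  have hφL : MemLp (fun x => conj (φ x)) 2 (volume.restrict (G.I e)) := by
    have h1 : Continuous fun x => conj (φ x) := Complex.continuous_conj.comp hφ.continuous
    exact (h1.memLp_of_hasCompactSupport (hc.comp_left (map_zero _))).restrict _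
  -- Pairing with `φ` is an inner product in `L²`, hence continuous along `P k → Q`.
  have hinner : ∀ R : G.L2, inner ℂ (hφL.toLp _) (R e) = ∫ x in K, R e x * φ x := by
    intro R
    rw [← hred (fun x => R e x * φ x) (fun x hx => by rw [hz x hx, mul_zero]), L2.inner_def,
      restrict_interior_I]
    refine integral_congr_ae ?_
    filter_upwards [hφL.coeFn_toLp] with x hx
    rw [RCLike.inner_apply, hx, Complex.conj_conj]
  have hlim2 : Tendsto (fun k => ∫ x in K, P k e x * φ x) atTop (𝓝 (∫ x in K, Q e x * φ x)) := by
    simp_rw [← hinner]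
    exact tendsto_const_nhds.inner (tendsto_L2_apply hP e)
  have hAφ : IntegrableOn (fun x => (A e x : ℂ) * φ x) K :=
    integrableOn_potential_mul hA hφ.continuous.continuousOn
  have hsplit : ∀ (R : G.L2) (u : G.Point → ℂ), Continuous u →
      ∫ x in interior (G.I e), Complex.I * (R e x + A e x * G.onEdges u e x) * φ x =
        Complex.I * ((∫ x in K, R e x * φ x) + ∫ x in K, ((A e x : ℂ) * φ x) * G.onEdges u e x) := by
    intro R u hu
    rw [hred _ fun x hx => by rw [hz x hx, mul_zero]]
    rw [← integral_add, ← integral_const_mul]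
    · congr 1
      ext x
      ring
    · exact (integrableOn_L2_apply R e n).mul_continuousOn hφ.continuous.continuousOn hK
    · exact hAφ.mul_continuousOn ((continuousOn_onEdges hu e).mono hKI) hK
  have hl1 := hlim (deriv φ) (hd.continuousOn.integrableOn_compact hK)
  have hl2 := ((hlim2.add (hlim _ hAφ)).const_mul Complex.I).neg
  rw [hsplit Q f hf, hred _ fun x hx => by rw [hz' x hx, mul_zero]]
  simp_rw [mul_comm (G.onEdges f e _) (deriv φ _)]
  refine tendsto_nhds_unique (hl1.congr fun k => ?_) hl2
  rw [← hsplit (P k) (F k) (hF k), ← (hFd k).2.2 φ hφ hc hs,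
    hred _ fun x hx => by rw [hz' x hx, mul_zero]]
  simp_rw [mul_comm (G.onEdges (F k) e _) (deriv φ _)]

theorem isClosed_formSpace (hconn : G.Connected) (hlf : G.LocallyFinite) (hA : G.MemLpLoc 2 A)
    (hV1 : ∀ e, ∀ x ∈ G.I e, 1 ≤ V e x) :
    IsClosed (formSpace G A V : Set (WithLp 2 (G.L2 × G.L2))) := by
  -- Without edges the edge conditions are vacuous, and every `p` is represented by `0`.
  rcases isEmpty_or_nonempty ℰ with hE | ⟨⟨e₀⟩⟩
  · convert isClosed_univ
    rw [eq_univ_iff_forall]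
    exact fun p => ⟨0, continuous_zero, fun e => isEmptyElim e, fun e => isEmptyElim e⟩
  refine IsSeqClosed.isClosed fun P p hPmem hP => ?_
  choose F hF using hPmem
  obtain ⟨f, hf⟩ := exists_limit_function hconn hA hV1 e₀ hF hP
  have hε : Tendsto (fun k => ‖P k - p‖) atTop (𝓝 0) := tendsto_iff_norm_sub_tendsto_zero.1 hP
  have hfc : Continuous f := continuous_of_locally_uniform_limit hconn hlf e₀ hε
    (fun _ => norm_nonneg _) (fun k => (hF k).continuous) hf
  have hfst : Tendsto (fun k => (P k).fst) atTop (𝓝 p.fst) :=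
    ((WithLp.fstL 2 ℂ G.L2 G.L2).continuous.tendsto p).comp hP
  have hsnd : Tendsto (fun k => (P k).snd) atTop (𝓝 p.snd) :=
    ((WithLp.sndL 2 ℂ G.L2 G.L2).continuous.tendsto p).comp hP
  refine ⟨f, hfc, fun e => hasWeakDeriv_limit hA hsnd hε hfc hf (fun k => (hF k).continuous) e
    fun k => (hF k).hasWeakDeriv e, fun e => ?_⟩
  -- A subsequence of `√V F k` converges a.e. to the `L²` limit, which the pointwise limit
  -- identifies as `√V f`.
  obtain ⟨ns, hns, hae⟩ :=
    (tendstoInMeasure_of_tendsto_Lp (tendsto_L2_apply hfst e)).exists_seq_tendsto_ae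
  have hrep : ∀ᵐ x ∂volume.restrict (G.I e), ∀ k,
      (P k).fst e x = (√(V e x) : ℂ) * G.onEdges (F k) e x :=
    ae_all_iff.2 fun k => (hF k).represents e
  have hmem : ∀ᵐ x ∂volume.restrict (G.I e), x ∈ G.I e := ae_restrict_mem (G.measurableSet_I e)
  filter_upwards [hae, hrep, hmem] with x h1 h2 h3
  obtain ⟨n, hn⟩ := exists_nat_ge x
  obtain ⟨C, -, hC⟩ := hf e n
  have h4 : Tendsto (fun k => G.onEdges (F k) e x) atTop (𝓝 (G.onEdges f e x)) := by
    rw [tendsto_iff_norm_sub_tendsto_zero]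
    refine squeeze_zero (fun _ => norm_nonneg _) (hC x ⟨h3, h3.1, hn⟩) ?_
    simpa using hε.const_mul C
  refine tendsto_nhds_unique h1 ?_
  simp_rw [h2]
  exact (h4.comp hns.tendsto_atTop).const_mul _

end Closed

/-! ### Density of the form domain in `L²`. -/

section Density

variable {A V : ℰ → ℝ → ℝ}

open Classical in
theorem exists_familyRepresents_single {e : ℰ} {g : ℝ → ℂ}
    (hg : MemLp g 2 (volume.restrict (G.I e))) :
    ∃ p : G.L2, FamilyRepresents (fun e' x => if e' = e then g x else 0) p := by
  refine ⟨lp.single 2 e (hg.toLp g), fun e' => ?_⟩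
  by_cases he : e' = e
  · subst he
    rw [lp.single_apply_self]
    simpa using hg.coeFn_toLp
  · rw [lp.single_apply_ne _ _ _ he]
    simp only [he, if_false]
    exact Lp.coeFn_zero ℂ 2 (volume.restrict (G.I e'))

/-- As `φ` is bounded on `K` and zero off `K`, square integrability of `a` is needed on `K` only.
Applied to `a = √V` and `a = A`. -/
theorem memLp_mul_testFunction {a φ : ℝ → ℂ} {I K : Set ℝ} (hK : IsCompact K)
    (ha : MemLp a 2 (volume.restrict K)) (hφ : Continuous φ)
    (hz : ∀ x, x ∉ K → φ x = 0) : MemLp (fun x => a x * φ x) 2 (volume.restrict I) := by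
  obtain ⟨C, hC⟩ := hK.exists_bound_of_continuousOn hφ.continuousOn
  have h1 : MemLp (fun x => a x * φ x) 2 (volume.restrict K) := by
    refine (ha.const_mul (C : ℂ)).of_le
      (ha.aestronglyMeasurable.mul hφ.aestronglyMeasurable) ?_
    refine (ae_restrict_iff' hK.measurableSet).2 (ae_of_all _ fun x hx => ?_)
    rw [norm_mul, norm_mul, mul_comm, Complex.norm_real]
    exact mul_le_mul_of_nonneg_right ((hC x hx).trans (le_abs_self C)) (norm_nonneg _)
  have h2 : (fun x => a x * φ x) = K.indicator fun x => a x * φ x := by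
    ext x
    by_cases hx : x ∈ K
    · rw [indicator_of_mem hx]
    · rw [indicator_of_notMem hx, hz x hx, mul_zero]
  rw [h2]
  exact ((memLp_indicator_iff_restrict hK.measurableSet).2 h1).restrict I

/-- Test functions on the interior of an edge belong to the magnetic Sobolev space. -/
theorem exists_isFormElement_extendByZero (hconn : G.Connected) (hA : G.MemLpLoc 2 A)
    (hV : G.MemLpLoc 1 V) (hV1 : ∀ e, ∀ x ∈ G.I e, 1 ≤ V e x) {e : ℰ} {φ : ℝ → ℂ}
    (hφ : ContDiff ℝ ∞ φ) (hc : HasCompactSupport φ) (hs : tsupport φ ⊆ interior (G.I e)) :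
    ∃ p, IsFormElement A V (G.extendByZero e φ) p := by
  classical
  have hφI : ∀ x, x ∉ interior (G.I e) → φ x = 0 := fun x hx =>
    image_eq_zero_of_notMem_tsupport fun hh => hx (hs hh)
  have hedge : ∀ e' x, G.onEdges (G.extendByZero e φ) e' x = if e' = e then φ x else 0 :=
    extendByZero_pt hφI
  obtain ⟨n, hn⟩ := exists_subset_I_inter hc (hs.trans interior_subset)
  have hK := isCompact_I_inter (G := G) e n
  have hKI : G.I e ∩ Icc 0 (n : ℝ) ⊆ G.I e := inter_subset_left
  have hz : ∀ x, x ∉ G.I e ∩ Icc 0 (n : ℝ) → φ x = 0 := fun x hx =>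
    image_eq_zero_of_notMem_tsupport fun hh => hx (hn hh)
  have hd : Continuous (deriv φ) := hφ.continuous_deriv (by simp)
  have hV0 : ∀ᵐ x ∂volume.restrict (G.I e ∩ Icc 0 (n : ℝ)), 0 ≤ V e x :=
    (ae_mono (Measure.restrict_mono_set _ hKI)) (ae_nonneg_potential hV1 e)
  have hsqrt : MemLp (fun x => (√(V e x) : ℂ)) 2 (volume.restrict (G.I e ∩ Icc 0 (n : ℝ))) := by
    have h1 : MemLp (fun x => √(V e x)) 2 (volume.restrict (G.I e ∩ Icc 0 (n : ℝ))) := by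
      have hVi := memLp_one_iff_integrable.1 (hV.memLp e n)
      rw [memLp_two_iff_integrable_sq
        (Real.continuous_sqrt.comp_aestronglyMeasurable hVi.aestronglyMeasurable)]
      refine hVi.congr ?_
      filter_upwards [hV0] with x hx
      rw [Real.sq_sqrt hx]
    exact h1.ofReal
  have hAφ : MemLp (fun x => (A e x : ℂ) * φ x) 2 (volume.restrict (G.I e)) :=
    memLp_mul_testFunction hK (hA.memLp e n).ofReal hφ.continuous hz
  have hdL : MemLp (deriv φ) 2 (volume.restrict (G.I e)) :=
    (hd.memLp_of_hasCompactSupport hc.deriv).restrict _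
  obtain ⟨a, ha⟩ := exists_familyRepresents_single (e := e)
    (memLp_mul_testFunction hK hsqrt hφ.continuous hz)
  -- This is `D_A φ = -i φ' - A φ`.
  obtain ⟨b, hb⟩ := exists_familyRepresents_single (e := e) ((hdL.const_mul (-Complex.I)).sub hAφ)
  obtain ⟨L, hL⟩ := hφ.lipschitzWith_of_hasCompactSupport hc (by simp)
  refine ⟨WithLp.toLp 2 (a, b), (lipschitzWith_extendByZero hφI hL hconn).continuous,
    fun e' => ?_, ha.congr fun e' => ae_of_all _ fun x => ?_⟩
  · have hw : HasWeakDeriv (interior (G.I e')) (G.onEdges (G.extendByZero e φ) e')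
        (fun x => if e' = e then deriv φ x else 0) := by
      have h1 : G.onEdges (G.extendByZero e φ) e' = fun x => if e' = e then φ x else 0 :=
        funext (hedge e')
      rw [h1]
      by_cases he : e' = e
      · simpa only [he, if_true] using
          hasWeakDeriv_deriv isOpen_interior (hφ.of_le (by simp))
      · simpa only [he, if_false, deriv_const'] using
          hasWeakDeriv_deriv (f := fun _ => (0 : ℂ)) isOpen_interior contDiff_const
    refine hw.congr_deriv ?_
    rw [restrict_interior_I]
    filter_upwards [hb e'] with x hx
    change _ = Complex.I * (b e' x + _)
    rw [hx, hedge]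
    by_cases he : e' = e
    · simp only [he, if_true, Pi.sub_apply]
      linear_combination deriv φ x * Complex.I_mul_I
    · simp [he]
  · simp only
    rw [hedge]
    by_cases he : e' = e
    · simp [he]
    · simp [he]

/-- An `h` orthogonal to the range is orthogonal to every test function inside every edge, so it
vanishes by the fundamental lemma of the calculus of variations. -/
theorem denseRange_of_familyRepresents (hconn : G.Connected) (hA : G.MemLpLoc 2 A)
    (hV : G.MemLpLoc 1 V) (hV1 : ∀ e, ∀ x ∈ G.I e, 1 ≤ V e x) {J : formSpace G A V →L[ℂ] G.L2}
    (hJ : ∀ (p : formSpace G A V) f, IsFormElement A V f p → FamilyRepresents (G.onEdges f) (J p)) :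
    DenseRange J := by
  classical
  have hrange : Dense ((LinearMap.range (J : formSpace G A V →ₗ[ℂ] G.L2) : Submodule ℂ G.L2) :
      Set G.L2) := by
    rw [Submodule.dense_iff_topologicalClosure_eq_top,
      Submodule.topologicalClosure_eq_top_iff, Submodule.eq_bot_iff]
    intro h hh
    rw [Submodule.mem_orthogonal] at hh
    refine (familyRepresents_self h).eq (familyRepresents_zero.congr fun e => ?_)
    have hloc : LocallyIntegrableOn (h e) (interior (G.I e)) :=
      locallyIntegrableOn_interior_I (integrableOn_L2_apply h e)
    have key := isOpen_interior.ae_eq_zero_of_integral_contDiff_smul_eq_zero hloc ?_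
    · have h1 := (ae_restrict_iff' measurableSet_interior).2 key
      rw [Measure.restrict_congr_set (G.interior_I_ae_eq e)] at h1
      filter_upwards [h1] with x hx
      exact hx.symm
    · intro g hg hc hs
      have hg' : ContDiff ℝ ∞ (fun x => (g x : ℂ)) := Complex.ofRealCLM.contDiff.comp hg
      have hc' : HasCompactSupport (fun x => (g x : ℂ)) := hc.comp_left Complex.ofReal_zero
      have hs' : tsupport (fun x => (g x : ℂ)) ⊆ interior (G.I e) :=
        (closure_mono (Function.support_comp_subset Complex.ofReal_zero g)).trans hs
      have hgz : ∀ x, x ∉ interior (G.I e) → g x = 0 := fun x hx =>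
        image_eq_zero_of_notMem_tsupport fun h => hx (hs h)
      obtain ⟨p, hp⟩ := exists_isFormElement_extendByZero hconn hA hV hV1 hg' hc' hs'
      have h0 := hh (J ⟨p, _, hp⟩) ⟨⟨p, _, hp⟩, rfl⟩
      have hsum := (hJ ⟨p, _, hp⟩ _ hp).hasSum_inner (familyRepresents_self h)
      rw [h0] at hsum
      have hedge : ∀ e' x, G.onEdges (G.extendByZero e fun x => (g x : ℂ)) e' x =
          if e' = e then (g x : ℂ) else 0 :=
        extendByZero_pt fun x hx => by rw [hgz x hx, Complex.ofReal_zero]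
      have hsingle := hasSum_single (f := fun e' => ∫ x in G.I e', h e' x *
        conj (G.onEdges (G.extendByZero e fun x => (g x : ℂ)) e' x)) e (fun e' he' => by
          simp [hedge, he'])
      have := hsingle.unique hsum
      simp only [hedge, if_true, Complex.conj_ofReal] at this
      rw [← this, ← setIntegral_eq_integral_of_forall_compl_eq_zero (s := G.I e)]
      · refine integral_congr_ae (ae_of_all _ fun x => ?_)
        simp only [Complex.real_smul, mul_comm]
      · intro x hx
        rw [hgz x fun h => hx (interior_subset h), zero_smul]
  exact hrange

end Density

end MetricGraph

/-! ### The representation theorem on the graph. -/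

/-- On a locally finite connected metric graph, with real `A ∈ L²_loc` and `1 ≤ V ∈ L¹_loc`, there
is exactly one self-adjoint operator `T` in `L²(𝒢, ℂ)` with `dom T ⊆ H¹_A(𝒢, ℂ)` such that
`Q(u, v) = (T u, v)₂ = ∫_𝒢 (T u) · conj v dx` for all `u ∈ dom T` and `v ∈ H¹_A(𝒢, ℂ)`. -/
theorem theorem2p2 {𝒱 ℰ : Type*} (G : MetricGraph 𝒱 ℰ) (hconn : G.Connected)
    (hlf : G.LocallyFinite) (A V : ℰ → ℝ → ℝ) (hA : G.MemLpLoc 2 A) (hV : G.MemLpLoc 1 V)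
    (hV1 : ∀ e, ∀ x ∈ G.I e, 1 ≤ V e x) :
    ∃! T : G.L2 →ₗ.[ℂ] G.L2, IsSelfAdjoint T ∧
      ∀ u : T.domain, ∃ f ∈ G.H1A A V, G.Represents f u ∧
        ∀ v ∈ G.H1A A V, G.Q A V f v =
          G.integral fun e x => (T u : G.L2) e x * conj (G.onEdges v e x) := by
  have : CompleteSpace (MetricGraph.formSpace G A V) :=
    (MetricGraph.isClosed_formSpace hconn hlf hA hV1).completeSpace_coe
  obtain ⟨J, hJ⟩ := MetricGraph.exists_embedding (G := G) (A := A) hV1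
  have hinj : Function.Injective J := by
    refine (injective_iff_map_eq_zero J).2 fun p hp => ?_
    obtain ⟨f, hf⟩ := p.2
    have h0 := hJ p f hf
    rw [hp] at h0
    exact Subtype.ext (hf.eq_zero h0)
  -- The condition on functions is rewritten in terms of `J`, so that the abstract theorem applies
  -- verbatim.
  have hiff : ∀ u h : G.L2, (∃ f ∈ G.H1A A V, G.Represents f u ∧
      ∀ v ∈ G.H1A A V, G.Q A V f v = G.integral fun e x => h e x * conj (G.onEdges v e x)) ↔
      ∃ x, J x = u ∧ ∀ y, inner ℂ y x = inner ℂ (J y) h := by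
    intro u h
    have hQ : ∀ (x y : MetricGraph.formSpace G A V) (f v : G.Point → ℂ),
        MetricGraph.IsFormElement A V f x → MetricGraph.IsFormElement A V v y →
        (G.Q A V f v = G.integral (fun e x => h e x * conj (G.onEdges v e x)) ↔
          inner ℂ y x = inner ℂ (J y) h) := by
      intro x y f v hf hv
      have h1 : inner ℂ (J y) h = G.integral fun e x => h e x * conj (G.onEdges v e x) :=
        ((hJ y v hv).hasSum_inner (MetricGraph.familyRepresents_self h)).tsum_eq.symm
      rw [hf.Q_eq_inner hV1 hv, ← h1]
      exact Iff.rfl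
    constructor
    · rintro ⟨f, hf, hu, hfv⟩
      obtain ⟨p, hp⟩ := (MetricGraph.mem_H1A_iff hV hV1).1 hf
      refine ⟨⟨p, f, hp⟩, (hJ _ f hp).eq hu, fun y => ?_⟩
      obtain ⟨v, hv⟩ := y.2
      exact (hQ _ y f v hp hv).1 (hfv v ((MetricGraph.mem_H1A_iff hV hV1).2 ⟨_, hv⟩))
    · rintro ⟨x, rfl, hx⟩
      obtain ⟨f, hf⟩ := x.2
      refine ⟨f, (MetricGraph.mem_H1A_iff hV hV1).2 ⟨_, hf⟩, hJ _ f hf, fun v hv => ?_⟩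
      obtain ⟨q, hq⟩ := (MetricGraph.mem_H1A_iff hV hV1).1 hv
      exact (hQ x ⟨q, v, hq⟩ f v hf hq).2 (hx _)
  simp_rw [hiff]
  exact existsUnique_isSelfAdjoint J hinj
    (MetricGraph.denseRange_of_familyRepresents hconn hA hV hV1 hJ)
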